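/- Let $n\ge 2$, let $H$ be a nonzero (hence infinite-dimensional) complex Hilbert space, and let $S_1,\dots,S_n\in B(H)$ be isometries with $\sum_{i=1}^n S_iS_i^*=1$. Let $O_n\subset B(H)$ be the C*-algebra they generate (the Cuntz algebra). For $a \in O_n$ write $\mathrm{Ad}\,a(x)=axa^*$. Let $\Phi_n(x)=\sum_{i=1}^n S_ixS_i^*$ be Cuntz's canonical endomorphism of $O_n$ and $\Psi_n(x)=\frac1n\sum_{i=1}^n S_i^*xS_i$. Let $F_n\subset O_n$ be the norm closure of $\bigcup_{k\ge 0}\mathrm{span}\{S_\mu S_\nu^*: \mu,\nu\in\{1,\dots,n\}^k\}$, where $S_\mu=S_{\mu_1}\cdots S_{\mu_k}$. For a linear map $\Phi:O_n\to O_n$, let $\Phi(O_n)'\subset B(H)$ be the commutant of its image. $\Phi$ is *irreducible* if $\Phi(O_n)'=\mathbb C1$. A *finite operational partition of unity* in $O_n$ is a finite family $(a_i)_{i=1}^m$ of nonzero elements of $O_n$ with $\sum_i a_ia_i^*=1$. Let $\mathrm{CP}(O_n)$ be the set of completely positive maps on $O_n$. A map $\Phi\in \mathrm{CP}(O_n)$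 is an *operational extreme point* of $\mathrm{CP}(O_n)$ if, whenever $\Phi=\sum_{i=1}^m \mathrm{Ad}\,a_i\circ\Theta_i$ with $\Theta_i\in \mathrm{CP}(O_n)$ and $(a_i)$ a finite operational partition of unity in $O_n$, then for each $i$ there is $z_i\in\Phi(O_n)'$ with $a_i\Theta_i(x)a_i^*=z_i\Phi(x)$ for all $x\in O_n$; it is a *numerical operational extreme point* if the $z_i$ can always be taken to be nonnegative real numbers. A linear map $\Phi$ on $O_n$ is a *Jordan homomorphism* if $\Phi(x^*)=\Phi(x)^*$ for all $x$ and $\Phi(a^2)=\Phi(a)^2$ for all self-adjoint $a$. Then: (i) $\Phi_n$ is not irreducible. (ii) $\Phi_n$ is an operational extreme point, but not a numerical operational extreme point, of $\mathrm{CP}(O_n)$. (iii) There is a unique state $\phi_n$ of $O_n$ with $\phi_n(ab)=\phi_n(ba)$ for all $a\in O_n$, $b\in F_n$, and $\phi_n\circ\Phi_n=\phi_n$. There is a unique linear map $\Phi_n^*$ on $O_n$ with $\langle\Phi_n(x),y\rangle=\langle x,\Phi_n^*(y)\rangle$ for all $x,y\in O_n$, where $\langle x,y\rangle=\phi_n(y^*x)$,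 and $\Phi_n^*=\Psi_n$. The map $\Phi_n^*$ is completely positive, it is not an operational extreme point of $\mathrm{CP}(O_n)$, and it is not even a Jordan homomorphism. -/

import Mathlib

open scoped ComplexOrder CStarAlgebra

namespace CuntzCP

/-! ### Order structure on a concrete C*-algebra -/

/-- In a C*-algebra, a self-adjoint element with nonnegative spectrum has the form `s^* s`. -/
theorem exists_eq_star_mul_self {B : Type*} [CStarAlgebra B] {x : B} (hx : IsSelfAdjoint x)
    (h : ∀ r ∈ spectrum ℝ x, 0 ≤ r) : ∃ s : B, x = star s * s := by
  let _ : PartialOrder B := CStarAlgebra.spectralOrder B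
  have : StarOrderedRing B := CStarAlgebra.spectralOrderedRing B
  exact CStarAlgebra.nonneg_iff_eq_star_mul_self.1
    ((StarOrderedRing.nonneg_iff_spectrum_nonneg x hx).2 h)

/-- A norm-closed unital `*`-subalgebra of `B(H)`, with the order inherited from `B(H)`, is a
star-ordered ring, i.e. its positive cone is the usual positive cone of a C*-algebra. -/
instance instStarOrderedRingStarSubalgebra {H : Type*} [NormedAddCommGroup H]
    [InnerProductSpace ℂ H] [CompleteSpace H] (B : StarSubalgebra ℂ (H →L[ℂ] H))
    [hB : IsClosed (B : Set (H →L[ℂ] H))] : StarOrderedRing B := by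
  have key : ∀ x : B, 0 ≤ x ↔ ∃ s : B, x = star s * s := by
    intro x
    constructor
    · intro hx
      have hx' : (0 : H →L[ℂ] H) ≤ (x : H →L[ℂ] H) := hx
      refine exists_eq_star_mul_self (Subtype.ext (IsSelfAdjoint.of_nonneg hx')) ?_
      intro r hr
      refine spectrum_nonneg_of_nonneg hx' ?_
      rw [← spectrum.algebraMap_mem_iff ℂ] at hr ⊢
      rwa [StarSubalgebra.spectrum_eq] at hr
    · rintro ⟨s, rfl⟩
      exact star_mul_self_nonneg (s : H →L[ℂ] H)
  refine StarOrderedRing.of_nonneg_iff' ?_ key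
  intro x y hxy z
  exact add_le_add_right (show (x : H →L[ℂ] H) ≤ y from hxy) (z : H →L[ℂ] H)

/-! ### Completely positive maps and operational extreme points -/

section General

/-- The set of all completely positive linear maps from `A` to `B`. -/
def cpMaps (A B : Type*) [CStarAlgebra A] [PartialOrder A] [StarOrderedRing A]
    [CStarAlgebra B] [PartialOrder B] [StarOrderedRing B] : Set (A →ₗ[ℂ] B) :=
  {f | ∃ g : A →CP B, g.toLinearMap = f}

/-- `{v₁, …, v_m}` is a finite operational partition of unity of size `m`: nonzero elements with
`∑ v_i v_i^* = 1`. -/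
structure IsFOP {B : Type*} [Ring B] [StarRing B] {m : ℕ} (v : Fin m → B) : Prop where
  ne_zero : ∀ i, v i ≠ 0
  sum_mul_star : ∑ i, v i * star (v i) = 1

/-- `Ad a : x ↦ a x a^*`. -/
noncomputable def Ad {B : Type*} [Ring B] [StarRing B] [Algebra ℂ B] (a : B) : B →ₗ[ℂ] B :=
  LinearMap.mulLeftRight ℂ (a, star a)

variable {H : Type*} [NormedAddCommGroup H] [InnerProductSpace ℂ H] [CompleteSpace H]

/-- The commutant in `B(H)` of the image of a map with values in a subalgebra of `B(H)`. -/
def imageCommutant {A : Type*} [AddCommGroup A] [Module ℂ A] {B : StarSubalgebra ℂ (H →L[ℂ] H)}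
    (Φ : A →ₗ[ℂ] B) : Set (H →L[ℂ] H) :=
  Set.centralizer (Set.range fun x : A => (Φ x : H →L[ℂ] H))

/-- The commutant of the image consists of the scalar operators. -/
def IsIrreducibleMap {A : Type*} [AddCommGroup A] [Module ℂ A]
    {B : StarSubalgebra ℂ (H →L[ℂ] H)} (Φ : A →ₗ[ℂ] B) : Prop :=
  imageCommutant Φ = Set.range fun c : ℂ => c • (1 : H →L[ℂ] H)

/-- `Φ` is an operational extreme point of `S`: whenever `Φ = ∑ Ad a_i ∘ Ψ_i` with `Ψ_i ∈ S` and
`{a_i}` a finite operational partition of unity in `B`, each `Ad a_i ∘ Ψ_i` equals `z_i Φ` for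
some `z_i` in the commutant (in `B(H)`) of the image of `Φ`. -/
def IsOperationalExtremePoint {A : Type*} [AddCommGroup A] [Module ℂ A]
    {B : StarSubalgebra ℂ (H →L[ℂ] H)} (S : Set (A →ₗ[ℂ] B)) (Φ : A →ₗ[ℂ] B) : Prop :=
  Φ ∈ S ∧ ∀ (m : ℕ) (a : Fin m → B) (Ψ : Fin m → (A →ₗ[ℂ] B)),
    IsFOP a → (∀ i, Ψ i ∈ S) → Φ = ∑ i, Ad (a i) ∘ₗ Ψ i →
      ∀ i, ∃ z ∈ imageCommutant Φ,
        ∀ x, ((Ad (a i) (Ψ i x) : B) : H →L[ℂ] H) = z * (Φ x : H →L[ℂ] H)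

/-- `Φ` is a numerical operational extreme point of `S`: as above, with the `z_i` nonnegative real
numbers. -/
def IsNumericalOperationalExtremePoint {A : Type*} [AddCommGroup A] [Module ℂ A]
    {B : StarSubalgebra ℂ (H →L[ℂ] H)} (S : Set (A →ₗ[ℂ] B)) (Φ : A →ₗ[ℂ] B) : Prop :=
  Φ ∈ S ∧ ∀ (m : ℕ) (a : Fin m → B) (Ψ : Fin m → (A →ₗ[ℂ] B)),
    IsFOP a → (∀ i, Ψ i ∈ S) → Φ = ∑ i, Ad (a i) ∘ₗ Ψ i →
      ∀ i, ∃ r : ℝ, 0 ≤ r ∧ Ad (a i) ∘ₗ Ψ i = (r : ℂ) • Φ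

/-- A self-adjoint linear map with `Φ(a²) = Φ(a)²` for all self-adjoint `a`. -/
structure IsJordanHom {A : Type*} [Ring A] [StarRing A] [Algebra ℂ A] (Φ : A →ₗ[ℂ] A) : Prop where
  map_star : ∀ x, Φ (star x) = star (Φ x)
  map_sq : ∀ a, IsSelfAdjoint a → Φ (a ^ 2) = Φ a ^ 2

/-- `T` is an adjoint of `Φ` for the inner product `⟨x, y⟩ = φ(y^* x)`, i.e.
`⟨Φ x, y⟩ = ⟨x, T y⟩` for all `x, y`. -/
def IsAdjointWrt {A : Type*} [Ring A] [StarRing A] [Algebra ℂ A] [PartialOrder A]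
    (φ : A →ₚ[ℂ] ℂ) (Φ T : A →ₗ[ℂ] A) : Prop :=
  ∀ x y, φ (star y * Φ x) = φ (star (T y) * x)

end General

/-! ### The Cuntz algebra -/

section Cuntz

variable {n : ℕ} {H : Type*} [NormedAddCommGroup H] [InnerProductSpace ℂ H] [CompleteSpace H]

/-- Isometries `S_1, …, S_n` on `H` with `∑ S_i S_i^* = 1`. -/
structure IsCuntzFamily (S : Fin n → (H →L[ℂ] H)) : Prop where
  isometry : ∀ i, star (S i) * S i = 1
  sum_mul_star : ∑ i, S i * star (S i) = 1

/-- The C*-algebra generated by `S_1, …, S_n`. -/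
noncomputable def cuntzAlgebra (S : Fin n → (H →L[ℂ] H)) : StarSubalgebra ℂ (H →L[ℂ] H) :=
  (StarAlgebra.adjoin ℂ (Set.range S)).topologicalClosure

instance instIsClosedCuntzAlgebra (S : Fin n → (H →L[ℂ] H)) :
    IsClosed (cuntzAlgebra S : Set (H →L[ℂ] H)) :=
  StarSubalgebra.isClosed_topologicalClosure _

/-- The generator `S_i` as an element of the algebra. -/
noncomputable def gen (S : Fin n → (H →L[ℂ] H)) (i : Fin n) : cuntzAlgebra S :=
  ⟨S i, StarSubalgebra.le_topologicalClosure _ (StarAlgebra.subset_adjoin ℂ _ ⟨i, rfl⟩)⟩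

/-- The word `S_μ = S_{μ_1} ⋯ S_{μ_k}`. -/
noncomputable def word (S : Fin n → (H →L[ℂ] H)) {k : ℕ} (μ : Fin k → Fin n) : cuntzAlgebra S :=
  (List.ofFn fun j => gen S (μ j)).prod

/-- The finite-dimensional algebra `F_n^k` spanned by all `S_μ S_ν^*` with `|μ| = |ν| = k`. -/
noncomputable def uhfLevel (S : Fin n → (H →L[ℂ] H)) (k : ℕ) : Submodule ℂ (cuntzAlgebra S) :=
  Submodule.span ℂ
    (Set.range fun p : (Fin k → Fin n) × (Fin k → Fin n) => word S p.1 * star (word S p.2))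

/-- The UHF algebra `F_n`, the norm closure of the union of the `F_n^k`. -/
noncomputable def uhf (S : Fin n → (H →L[ℂ] H)) : Set (cuntzAlgebra S) :=
  closure (⋃ k : ℕ, (uhfLevel S k : Set (cuntzAlgebra S)))

/-- `φ` is a state with `φ(ab) = φ(ba)` for all `a ∈ O_n` and `b ∈ F_n`. -/
structure IsUHFTraceLikeState (S : Fin n → (H →L[ℂ] H)) (φ : cuntzAlgebra S →ₚ[ℂ] ℂ) : Prop where
  map_one : φ 1 = 1
  trace_like : ∀ a, ∀ b ∈ uhf S, φ (a * b) = φ (b * a)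

/-- The canonical endomorphism `Φ_n(x) = ∑ S_i x S_i^*`. -/
noncomputable def canonicalEndo (S : Fin n → (H →L[ℂ] H)) :
    cuntzAlgebra S →ₗ[ℂ] cuntzAlgebra S :=
  ∑ i, Ad (gen S i)

/-- The standard left inverse `Ψ_n(x) = (1/n) ∑ S_i^* x S_i`. -/
noncomputable def leftInverse (S : Fin n → (H →L[ℂ] H)) :
    cuntzAlgebra S →ₗ[ℂ] cuntzAlgebra S :=
  (n : ℂ)⁻¹ • ∑ i, Ad (star (gen S i))

end Cuntz

end CuntzCP

/-!
The argument takes place in a C*-algebra `A` generated by a Cuntz tuple `s`, with canonical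
endomorphism `Φ(x) = ∑ s_i x s_i^*` and averaged left inverse `Ψ(x) = (1/n) ∑ s_i^* x s_i`, so that
`Ψ ∘ Φ = id`. Neither a universal property of `O_n` nor its gauge action is used.

*The canonical state.* `Ψ` strips one letter off both words of a monomial `s_μ s_ν^*`, up to a
factor, and rotates a single word cyclically with a factor `1/n`. Hence `Ψ^k(x)` converges in norm
to a scalar `φ(x) 1` for every `x` (`IsCuntzTuple.exists_tendsto_linv_pow`), which defines `φ` and
yields `φ ∘ Φ = φ`, `φ ∘ Ψ = φ` and the relation `φ(s_i x) = φ(x s_i) / n`. A functional `f` that is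
tracial against the UHF algebra satisfies `f ∘ Φ^k ∘ Ψ^k = f` (`apply_endo_pow_linv_pow`), and
`Φ^k(Ψ^k(x))` tends to `φ(x) 1`; this is the uniqueness of `φ`.

*Uniqueness of the adjoint.* Existence follows from `Ψ(y^* Φ(x)) = Ψ(y)^* x`. Uniqueness amounts to
the nondegeneracy of `φ`, which is the hard part (`eq_zero_of_kernel`). By the relation above it
suffices to show that `z = 0` if `φ(x z y) = 0` for all `x, y`. For `i ≠ j` and `k ≤ N` the shifts
`w_k = Φ^k(s_i s_j^N)` are isometries with orthogonal ranges. Compression by `w_k` sends a monomial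
of length at most `k` to a level of the UHF algebra, where simplicity of matrix algebras bounds the
norm of an element by its distance from the kernel; so `z w_k` tends to `0`. On the other hand the
normalized means of `m` consecutive `w_k` are isometries `u` with `‖Φ(u) - u‖ ≤ 2 / √m`, hence are
asymptotically central. So `u z` is close to `z u`, which is small, and therefore `z = 0`.

*Extremality.* If a `*`-homomorphism is a sum of maps `Ψ_i = Ad a_i ∘ Θ_i`, positivity of
`2 × 2` matrices forces `Ψ_i(x) = Ψ_i(1) Φ(x)` (`Ad_comp_eq_of_sum_eq_starAlgHom`), so `Φ` is an
operational extreme point. The negative assertions come from the projections `s_i s_i^*`: they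
commute with the image of `Φ` but are not scalar, and `Ψ(s_i s_i^*) = 1/n`. The decompositions
`Φ = ∑ Ad s_i` and `Ψ = ∑ (1/n) Ad s_i^*` are the ones that are not trivial.
-/

namespace CuntzCP

open Filter Topology

/-! ### Cuntz tuples in a C*-algebra -/

/-- `n` isometries of a C*-algebra whose range projections sum to `1`. -/
structure IsCuntzTuple {n : ℕ} {A : Type*} [CStarAlgebra A] (s : Fin n → A) : Prop where
  star_mul_self : ∀ i, star (s i) * s i = 1
  sum_mul_star : ∑ i, s i * star (s i) = 1

namespace IsCuntzTuple

variable {n : ℕ} {A : Type*} [CStarAlgebra A] {s : Fin n → A}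

theorem star_mul_of_ne (hs : IsCuntzTuple s) {i j : Fin n} (h : i ≠ j) :
    star (s i) * s j = 0 := by
  let _ : PartialOrder A := CStarAlgebra.spectralOrder A
  have : StarOrderedRing A := CStarAlgebra.spectralOrderedRing A
  have h1 : ∑ k, star (star (s k) * s j) * (star (s k) * s j) = 1 := by
    calc _ = star (s j) * (∑ k, s k * star (s k)) * s j := by
          rw [Finset.mul_sum, Finset.sum_mul]
          exact Finset.sum_congr rfl fun k _ => by simp [mul_assoc]
      _ = 1 := by rw [hs.sum_mul_star, mul_one, hs.star_mul_self]
  rw [← Finset.add_sum_erase _ _ (Finset.mem_univ j), hs.star_mul_self] at h1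
  have h2 : ∑ k ∈ Finset.univ.erase j, star (star (s k) * s j) * (star (s k) * s j) = 0 := by
    simpa using h1
  rw [Finset.sum_eq_zero_iff_of_nonneg fun k _ => star_mul_self_nonneg _] at h2
  exact (CStarRing.star_mul_self_eq_zero_iff _).1 (h2 i (by simp [h]))

theorem star_gen_mul_gen (hs : IsCuntzTuple s) (i j : Fin n) :
    star (s i) * s j = if i = j then 1 else 0 := by
  split_ifs with h
  · rw [h, hs.star_mul_self]
  · exact hs.star_mul_of_ne h

theorem star_gen_mul_gen_mul (hs : IsCuntzTuple s) (i j : Fin n) (x : A) :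
    star (s i) * (s j * x) = if i = j then x else 0 := by
  rw [← mul_assoc, hs.star_gen_mul_gen]; split_ifs <;> simp

/-- The canonical endomorphism `x ↦ ∑ s_i x s_i^*` as a unital `*`-homomorphism. -/
noncomputable def endo (hs : IsCuntzTuple s) : A →⋆ₐ[ℂ] A where
  toFun x := ∑ i, s i * x * star (s i)
  map_one' := by simpa using hs.sum_mul_star
  map_mul' x y := by
    rw [Finset.sum_mul]
    refine Finset.sum_congr rfl fun i _ => ?_
    rw [Finset.mul_sum, Finset.sum_eq_single i]
    · simp only [mul_assoc, hs.star_gen_mul_gen_mul, if_true]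
    · intro j _ hj
      simp [mul_assoc, hs.star_gen_mul_gen_mul, hj.symm]
    · simp
  map_zero' := by simp
  map_add' x y := by simp [mul_add, add_mul, Finset.sum_add_distrib]
  commutes' c := by
    simp only [Algebra.algebraMap_eq_smul_one, mul_smul_comm, mul_one, smul_mul_assoc]
    rw [← Finset.smul_sum, hs.sum_mul_star]
  map_star' x := by simp [mul_assoc]

theorem endo_apply (hs : IsCuntzTuple s) (x : A) : hs.endo x = ∑ i, s i * x * star (s i) := rfl

theorem endo_mul_gen (hs : IsCuntzTuple s) (x : A) (i : Fin n) : hs.endo x * s i = s i * x := by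
  rw [endo_apply, Finset.sum_mul, Finset.sum_eq_single i]
  · rw [mul_assoc, hs.star_mul_self, mul_one]
  · intro j _ hj
    rw [mul_assoc, hs.star_mul_of_ne hj, mul_zero]
  · simp

theorem star_gen_mul_endo (hs : IsCuntzTuple s) (x : A) (i : Fin n) :
    star (s i) * hs.endo x = x * star (s i) := by
  have := congrArg star (hs.endo_mul_gen (star x) i)
  simpa [map_star] using this

theorem endo_pow_succ_apply (hs : IsCuntzTuple s) (k : ℕ) (x : A) :
    (hs.endo ^ (k + 1)) x = hs.endo ((hs.endo ^ k) x) := by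
  rw [pow_succ']; rfl

theorem norm_endo_pow_le (hs : IsCuntzTuple s) (k : ℕ) (x : A) : ‖(hs.endo ^ k) x‖ ≤ ‖x‖ :=
  NonUnitalStarAlgHom.norm_apply_le (hs.endo ^ k) x

theorem norm_gen [Nontrivial A] (hs : IsCuntzTuple s) (i : Fin n) : ‖s i‖ = 1 := by
  have h : ‖s i‖ * ‖s i‖ = 1 := by
    rw [← CStarRing.norm_star_mul_self, hs.star_mul_self, norm_one]
  nlinarith [norm_nonneg (s i)]

end IsCuntzTuple

section

variable {n : ℕ} {A : Type*} [CStarAlgebra A] {s : Fin n → A}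

/-- The `*`-algebra generated by the family is dense. -/
def TopGenerates (s : Fin n → A) : Prop :=
  (StarAlgebra.adjoin ℂ (Set.range s)).topologicalClosure = ⊤

/-- A subspace that contains `1` and is stable under left multiplication by generators and
their adjoints is dense. -/
theorem TopGenerates.mem_closure_of_left_stable (hg : TopGenerates s) (V : Submodule ℂ A)
    (one : (1 : A) ∈ V) (hl : ∀ i, ∀ x ∈ V, s i * x ∈ V)
    (hr : ∀ i, ∀ x ∈ V, star (s i) * x ∈ V) (x : A) : x ∈ closure (V : Set A) := by
  have h1 : ∀ y ∈ StarAlgebra.adjoin ℂ (Set.range s), y ∈ V := by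
    intro y hy
    have hy' : y ∈ Subalgebra.toSubmodule (StarAlgebra.adjoin ℂ (Set.range s)).toSubalgebra := hy
    rw [StarAlgebra.adjoin_eq_span] at hy'
    refine Submodule.span_le.2 ?_ hy'
    intro z hz
    induction hz using Submonoid.closure_induction_left with
    | one => exact one
    | mul_left a ha y hy ih =>
      rcases ha with ⟨i, rfl⟩ | ⟨i, hi⟩
      · exact hl i _ ih
      · rw [← star_star a, ← hi]
        exact hr i _ ih
  have hx : x ∈ (StarAlgebra.adjoin ℂ (Set.range s)).topologicalClosure := by
    rw [hg]; trivial
  exact closure_mono (fun y hy => h1 y hy) hx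

/-- A closed subspace that contains `1` and is stable under left multiplication by generators and
their adjoints is everything. -/
theorem TopGenerates.mem_of_left_stable (hg : TopGenerates s) (V : Submodule ℂ A)
    (hV : IsClosed (V : Set A)) (one : (1 : A) ∈ V) (hl : ∀ i, ∀ x ∈ V, s i * x ∈ V)
    (hr : ∀ i, ∀ x ∈ V, star (s i) * x ∈ V) (x : A) : x ∈ V :=
  hV.closure_subset (hg.mem_closure_of_left_stable V one hl hr x)

/-- The averaged left inverse `x ↦ (1/n) ∑ s_i^* x s_i` of the canonical endomorphism. -/
noncomputable def linv (s : Fin n → A) : A →ₗ[ℂ] A := (n : ℂ)⁻¹ • ∑ i, Ad (star (s i))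

theorem linv_apply (s : Fin n → A) (x : A) :
    linv s x = (n : ℂ)⁻¹ • ∑ i, star (s i) * x * s i := by
  simp [linv, Ad]

theorem star_linv (s : Fin n → A) (x : A) : star (linv s x) = linv s (star x) := by
  simp [linv_apply, mul_assoc]

theorem IsCuntzTuple.natCast_ne_zero [Nontrivial A] (hs : IsCuntzTuple s) : (n : ℂ) ≠ 0 := by
  rintro h
  have : n = 0 := by exact_mod_cast h
  subst this
  simpa using hs.sum_mul_star

theorem IsCuntzTuple.linv_mul_endo [Nontrivial A] (hs : IsCuntzTuple s) (x y : A) :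
    linv s (x * hs.endo y) = linv s x * y := by
  simp only [linv_apply, smul_mul_assoc, Finset.sum_mul]
  congr 1
  refine Finset.sum_congr rfl fun i _ => ?_
  rw [mul_assoc, mul_assoc, hs.endo_mul_gen]
  simp [mul_assoc]

theorem IsCuntzTuple.linv_one [Nontrivial A] (hs : IsCuntzTuple s) : linv s 1 = 1 := by
  simp [linv_apply, hs.star_mul_self, ← Nat.cast_smul_eq_nsmul ℂ, smul_smul,
    inv_mul_cancel₀ hs.natCast_ne_zero]

theorem IsCuntzTuple.linv_endo [Nontrivial A] (hs : IsCuntzTuple s) (x : A) :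
    linv s (hs.endo x) = x := by
  simpa [hs.linv_one] using hs.linv_mul_endo 1 x

theorem IsCuntzTuple.norm_linv_le [Nontrivial A] (hs : IsCuntzTuple s) (x : A) :
    ‖linv s x‖ ≤ ‖x‖ := by
  have hn : (n : ℝ) ≠ 0 := by exact_mod_cast hs.natCast_ne_zero
  rw [linv_apply, norm_smul]
  have : ‖∑ i, star (s i) * x * s i‖ ≤ n * ‖x‖ := by
    refine (norm_sum_le_of_le (n := fun _ => ‖x‖) Finset.univ fun i _ => ?_).trans_eq (by simp)
    calc _ ≤ ‖star (s i)‖ * ‖x‖ * ‖s i‖ := norm_mul₃_le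
      _ = ‖x‖ := by simp [hs.norm_gen]
  calc _ ≤ ‖(n : ℂ)⁻¹‖ * (n * ‖x‖) := by gcongr
    _ = ‖x‖ := by simp; field_simp

theorem IsCuntzTuple.norm_linv_pow_le [Nontrivial A] (hs : IsCuntzTuple s) (k : ℕ) (x : A) :
    ‖(linv s ^ k) x‖ ≤ ‖x‖ := by
  induction k with
  | zero => simp
  | succ k ih =>
    rw [pow_succ', Module.End.mul_apply]
    exact (hs.norm_linv_le _).trans ih

theorem IsCuntzTuple.linv_pow_one [Nontrivial A] (hs : IsCuntzTuple s) (k : ℕ) :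
    (linv s ^ k) 1 = 1 := by
  induction k with
  | zero => simp
  | succ k ih => rw [pow_succ, Module.End.mul_apply, hs.linv_one, ih]

theorem star_linv_pow (s : Fin n → A) (k : ℕ) (x : A) :
    star ((linv s ^ k) x) = (linv s ^ k) (star x) := by
  induction k with
  | zero => simp
  | succ k ih => rw [pow_succ', Module.End.mul_apply, Module.End.mul_apply, star_linv, ih]

end

/-! ### Words and monomials -/

section

variable {n : ℕ} {A : Type*} [CStarAlgebra A] {s : Fin n → A}

/-- The product of the generators indexed by a list. -/
noncomputable def listWord (s : Fin n → A) (l : List (Fin n)) : A := (l.map s).prod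

@[simp] theorem listWord_nil (s : Fin n → A) : listWord s [] = 1 := rfl

@[simp] theorem listWord_cons (s : Fin n → A) (i : Fin n) (l : List (Fin n)) :
    listWord s (i :: l) = s i * listWord s l := by simp [listWord]

theorem listWord_append (s : Fin n → A) (l l' : List (Fin n)) :
    listWord s (l ++ l') = listWord s l * listWord s l' := by simp [listWord]

/-- The span of all monomials `s_μ s_ν^*`. -/
noncomputable def monomialSpan (s : Fin n → A) : Submodule ℂ A :=
  Submodule.span ℂ
    (Set.range fun p : List (Fin n) × List (Fin n) => listWord s p.1 * star (listWord s p.2))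

theorem mem_closure_monomialSpan (hs : IsCuntzTuple s) (hg : TopGenerates s) (x : A) :
    x ∈ closure (monomialSpan s : Set A) := by
  refine hg.mem_closure_of_left_stable (monomialSpan s)
    (Submodule.subset_span ⟨([], []), by simp⟩) ?_ ?_ x
  · intro i y hy
    refine (Submodule.span_le (p := (monomialSpan s).comap (LinearMap.mulLeft ℂ (s i)))).2 ?_ hy
    rintro _ ⟨⟨μ, ν⟩, rfl⟩
    exact Submodule.subset_span ⟨(i :: μ, ν), by simp [mul_assoc]⟩
  · intro i y hy
    refine (Submodule.span_le
      (p := (monomialSpan s).comap (LinearMap.mulLeft ℂ (star (s i))))).2 ?_ hy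
    rintro _ ⟨⟨μ, ν⟩, rfl⟩
    cases μ with
    | nil => exact Submodule.subset_span ⟨([], ν ++ [i]), by simp [listWord_append]⟩
    | cons j μ =>
      by_cases hij : i = j
      · subst hij
        exact Submodule.subset_span ⟨(μ, ν), by simp [mul_assoc, hs.star_gen_mul_gen_mul]⟩
      · simp [mul_assoc, hs.star_gen_mul_gen_mul, hij]

/-! ### The limit of the iterated left inverse -/

theorem IsCuntzTuple.linv_gen_mul (hs : IsCuntzTuple s) (i : Fin n) (x : A) :
    linv s (s i * x) = (n : ℂ)⁻¹ • (x * s i) := by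
  rw [linv_apply, Finset.sum_eq_single i]
  · rw [← mul_assoc, hs.star_mul_self, one_mul]
  · intro j _ hj
    rw [← mul_assoc, hs.star_mul_of_ne hj, zero_mul, zero_mul]
  · simp

theorem IsCuntzTuple.norm_listWord_le [Nontrivial A] (hs : IsCuntzTuple s) (l : List (Fin n)) :
    ‖listWord s l‖ ≤ 1 := by
  induction l with
  | nil => simp
  | cons i l ih =>
    rw [listWord_cons]
    calc _ ≤ ‖s i‖ * ‖listWord s l‖ := norm_mul_le _ _
      _ ≤ 1 := by rw [hs.norm_gen, one_mul]; exact ih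

/-- On words of positive length the left inverse acts as `1/n` times a cyclic rotation, so its
iterates decay. -/
theorem IsCuntzTuple.norm_linv_pow_listWord_le [Nontrivial A] (hs : IsCuntzTuple s) (k : ℕ)
    {l : List (Fin n)} (hl : l ≠ []) : ‖(linv s ^ k) (listWord s l)‖ ≤ ((n : ℝ)⁻¹) ^ k := by
  induction k generalizing l with
  | zero => simpa using hs.norm_listWord_le l
  | succ k ih =>
    cases l with
    | nil => exact absurd rfl hl
    | cons i l =>
      have h : listWord s l * s i = listWord s (l ++ [i]) := by simp [listWord_append]
      rw [pow_succ, Module.End.mul_apply, listWord_cons, hs.linv_gen_mul, map_smul, norm_smul, h,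
        pow_succ']
      have := ih (l := l ++ [i]) (by simp)
      simpa using mul_le_mul_of_nonneg_left this (by positivity : 0 ≤ ‖(n : ℂ)⁻¹‖)

theorem IsCuntzTuple.tendsto_linv_pow_listWord [Nontrivial A] (hs : IsCuntzTuple s) (hn : 2 ≤ n)
    {l : List (Fin n)} (hl : l ≠ []) :
    Tendsto (fun k => (linv s ^ k) (listWord s l)) atTop (𝓝 0) := by
  refine squeeze_zero_norm (fun k => hs.norm_linv_pow_listWord_le k hl) ?_
  have : (2 : ℝ) ≤ n := by exact_mod_cast hn
  exact tendsto_pow_atTop_nhds_zero_of_lt_one (by positivity) (inv_lt_one_of_one_lt₀ (by linarith))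

theorem IsCuntzTuple.exists_tendsto_linv_pow_monomial [Nontrivial A] (hs : IsCuntzTuple s)
    (hn : 2 ≤ n) (μ ν : List (Fin n)) :
    ∃ c : ℂ, Tendsto (fun k => (linv s ^ k) (listWord s μ * star (listWord s ν))) atTop
      (𝓝 (c • (1 : A))) := by
  induction μ generalizing ν with
  | nil =>
    by_cases hν : ν = []
    · exact ⟨1, by simp [hν, hs.linv_pow_one]⟩
    · refine ⟨0, ?_⟩
      have := (hs.tendsto_linv_pow_listWord hn hν).star
      simpa [star_linv_pow] using this
  | cons i μ ih =>
    cases ν with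
    | nil => exact ⟨0, by simpa using hs.tendsto_linv_pow_listWord hn (List.cons_ne_nil i μ)⟩
    | cons j ν =>
      obtain ⟨c, hc⟩ := ih ν
      refine ⟨(n : ℂ)⁻¹ * (if i = j then c else 0), ?_⟩
      rw [← tendsto_add_atTop_iff_nat 1]
      have h : linv s (listWord s (i :: μ) * star (listWord s (j :: ν))) =
          ((n : ℂ)⁻¹ * (if i = j then 1 else 0)) • (listWord s μ * star (listWord s ν)) := by
        rw [listWord_cons, mul_assoc, hs.linv_gen_mul, listWord_cons, star_mul, mul_assoc,
          mul_assoc, hs.star_gen_mul_gen]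
        by_cases hij : i = j
        · simp [hij]
        · simp [hij, Ne.symm hij]
      simp only [pow_succ, Module.End.mul_apply, h, map_smul]
      have := hc.const_smul ((n : ℂ)⁻¹ * (if i = j then 1 else 0))
      by_cases hij : i = j
      · simpa [hij, smul_smul] using this
      · simp [hij]

/-- The elements whose images under the iterated left inverse converge in norm to a scalar. -/
def scalarLimitSubmodule (s : Fin n → A) : Submodule ℂ A where
  carrier := {x | ∃ c : ℂ, Tendsto (fun k => (linv s ^ k) x) atTop (𝓝 (c • (1 : A)))}
  zero_mem' := ⟨0, by simp⟩
  add_mem' := by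
    rintro x y ⟨c, hc⟩ ⟨d, hd⟩
    exact ⟨c + d, by simpa [add_smul] using hc.add hd⟩
  smul_mem' := by
    rintro a x ⟨c, hc⟩
    exact ⟨a * c, by simpa [smul_smul] using hc.const_smul a⟩

theorem IsCuntzTuple.isClosed_scalarLimitSubmodule [Nontrivial A] (hs : IsCuntzTuple s) :
    IsClosed (scalarLimitSubmodule s : Set A) := by
  refine isClosed_of_closure_subset fun x hx => ?_
  have happ : ∀ ε > 0, ∃ y ∈ scalarLimitSubmodule s, ∀ k,
      dist ((linv s ^ k) x) ((linv s ^ k) y) < ε := by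
    intro ε hε
    obtain ⟨y, hy, hxy⟩ := Metric.mem_closure_iff.1 hx ε hε
    refine ⟨y, hy, fun k => ?_⟩
    rw [dist_eq_norm, ← map_sub]
    exact (hs.norm_linv_pow_le k _).trans_lt (by rwa [← dist_eq_norm])
  have hc : CauchySeq fun k => (linv s ^ k) x := by
    refine Metric.cauchySeq_iff'.2 fun ε hε => ?_
    obtain ⟨y, ⟨c, hy⟩, hxy⟩ := happ (ε / 3) (by positivity)
    obtain ⟨N, hN⟩ := Metric.cauchySeq_iff'.1 hy.cauchySeq (ε / 3) (by positivity)
    refine ⟨N, fun k hk => ?_⟩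
    have h1 := hxy k
    have h2 := hxy N
    have h3 := hN k hk
    rw [dist_comm] at h2
    have := dist_triangle4 ((linv s ^ k) x) ((linv s ^ k) y) ((linv s ^ N) y) ((linv s ^ N) x)
    linarith
  obtain ⟨z, hz⟩ := cauchySeq_tendsto_of_complete hc
  have hzc : z ∈ closure (Submodule.span ℂ {(1 : A)} : Set A) := by
    refine Metric.mem_closure_iff.2 fun ε hε => ?_
    obtain ⟨y, ⟨c, hy⟩, hxy⟩ := happ (ε / 2) (by positivity)
    refine ⟨c • 1, Submodule.smul_mem _ _ (Submodule.mem_span_singleton_self _), ?_⟩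
    have := le_of_tendsto (hz.dist hy) (Eventually.of_forall fun k => (hxy k).le)
    linarith
  rw [(Submodule.closed_of_finiteDimensional _).closure_eq] at hzc
  obtain ⟨c, rfl⟩ := Submodule.mem_span_singleton.1 hzc
  exact ⟨c, hz⟩

theorem IsCuntzTuple.exists_tendsto_linv_pow [Nontrivial A] (hs : IsCuntzTuple s)
    (hg : TopGenerates s) (hn : 2 ≤ n) (x : A) :
    ∃ c : ℂ, Tendsto (fun k => (linv s ^ k) x) atTop (𝓝 (c • (1 : A))) := by
  have h : monomialSpan s ≤ scalarLimitSubmodule s := by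
    refine Submodule.span_le.2 ?_
    rintro _ ⟨⟨μ, ν⟩, rfl⟩
    exact hs.exists_tendsto_linv_pow_monomial hn μ ν
  exact closure_minimal h hs.isClosed_scalarLimitSubmodule (mem_closure_monomialSpan hs hg x)

/-- The functional `φ` determined by `φ(x) 1 = lim_k Ψ^k(x)`, where `Ψ` is the averaged left
inverse of the canonical endomorphism. -/
noncomputable def limitFunctional [Nontrivial A] (hs : IsCuntzTuple s) (hg : TopGenerates s)
    (hn : 2 ≤ n) : A →ₗ[ℂ] ℂ where
  toFun x := (hs.exists_tendsto_linv_pow hg hn x).choose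
  map_add' x y := by
    refine smul_left_injective ℂ (one_ne_zero (α := A)) (tendsto_nhds_unique
      (hs.exists_tendsto_linv_pow hg hn (x + y)).choose_spec ?_)
    simpa [add_smul] using (hs.exists_tendsto_linv_pow hg hn x).choose_spec.add
      (hs.exists_tendsto_linv_pow hg hn y).choose_spec
  map_smul' a x := by
    refine smul_left_injective ℂ (one_ne_zero (α := A)) (tendsto_nhds_unique
      (hs.exists_tendsto_linv_pow hg hn (a • x)).choose_spec ?_)
    simpa [smul_smul] using (hs.exists_tendsto_linv_pow hg hn x).choose_spec.const_smul a

variable [Nontrivial A] (hs : IsCuntzTuple s) (hg : TopGenerates s) (hn : 2 ≤ n)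

theorem tendsto_limitFunctional (x : A) :
    Tendsto (fun k => (linv s ^ k) x) atTop (𝓝 (limitFunctional hs hg hn x • (1 : A))) :=
  (hs.exists_tendsto_linv_pow hg hn x).choose_spec

theorem limitFunctional_eq {x : A} {c : ℂ}
    (h : Tendsto (fun k => (linv s ^ k) x) atTop (𝓝 (c • (1 : A)))) :
    limitFunctional hs hg hn x = c :=
  smul_left_injective ℂ (one_ne_zero (α := A))
    (tendsto_nhds_unique (tendsto_limitFunctional hs hg hn x) h)

theorem limitFunctional_one : limitFunctional hs hg hn 1 = 1 :=
  limitFunctional_eq hs hg hn (by simp [hs.linv_pow_one])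

theorem limitFunctional_linv (x : A) :
    limitFunctional hs hg hn (linv s x) = limitFunctional hs hg hn x := by
  refine limitFunctional_eq hs hg hn ?_
  have := (tendsto_add_atTop_iff_nat 1).2 (tendsto_limitFunctional hs hg hn x)
  simpa [pow_succ] using this

theorem limitFunctional_endo (x : A) :
    limitFunctional hs hg hn (hs.endo x) = limitFunctional hs hg hn x := by
  rw [← limitFunctional_linv, hs.linv_endo]

theorem norm_limitFunctional_le (x : A) : ‖limitFunctional hs hg hn x‖ ≤ ‖x‖ := by
  have := le_of_tendsto (tendsto_limitFunctional hs hg hn x).norm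
    (Eventually.of_forall fun k => hs.norm_linv_pow_le k x)
  simpa [norm_smul] using this

theorem continuous_limitFunctional : Continuous (limitFunctional hs hg hn) :=
  AddMonoidHomClass.continuous_of_bound (limitFunctional hs hg hn) 1
    (by simpa using norm_limitFunctional_le hs hg hn)

/-- The Kubo–Martin–Schwinger type relation `φ(s_i x) = φ(x s_i) / n`. -/
theorem limitFunctional_gen_mul (i : Fin n) (x : A) :
    limitFunctional hs hg hn (s i * x) = (n : ℂ)⁻¹ * limitFunctional hs hg hn (x * s i) := by
  rw [← limitFunctional_linv, hs.linv_gen_mul, map_smul, smul_eq_mul]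

theorem limitFunctional_mul_star_gen (i : Fin n) (x : A) :
    limitFunctional hs hg hn (x * star (s i)) =
      (n : ℂ)⁻¹ * limitFunctional hs hg hn (star (s i) * x) := by
  have h : linv s (x * star (s i)) = (n : ℂ)⁻¹ • (star (s i) * x) := by
    have := congrArg star (hs.linv_gen_mul i (star x))
    simpa [star_linv] using this
  rw [← limitFunctional_linv, h, map_smul, smul_eq_mul]

theorem limitFunctional_nonneg [PartialOrder A] [StarOrderedRing A] {x : A} (hx : 0 ≤ x) :
    0 ≤ limitFunctional hs hg hn x := by
  have h1 : ∀ k, 0 ≤ (linv s ^ k) x := by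
    intro k
    induction k with
    | zero => simpa
    | succ k ih =>
      rw [pow_succ', Module.End.mul_apply, linv_apply]
      refine smul_nonneg (by positivity) (Finset.sum_nonneg fun i _ => ?_)
      simpa using star_left_conjugate_nonneg ih (s i)
  have h2 : 0 ≤ limitFunctional hs hg hn x • (1 : A) :=
    ge_of_tendsto' (tendsto_limitFunctional hs hg hn x) h1
  rw [← Algebra.algebraMap_eq_smul_one] at h2
  have h3 : limitFunctional hs hg hn x ∈
      spectrum ℂ (algebraMap ℂ A (limitFunctional hs hg hn x)) := by
    rw [spectrum.scalar_eq]; rfl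
  exact spectrum_nonneg_of_nonneg h2 h3

end

/-! ### Matrix units and the trace property -/

section

variable {n : ℕ} {A : Type*} [CStarAlgebra A] {s : Fin n → A}

/-- The span of all `s_μ s_ν^*` with `|μ| = |ν| = k`. -/
noncomputable def levelSpan (s : Fin n → A) (k : ℕ) : Submodule ℂ A :=
  Submodule.span ℂ (Set.range fun p : (Fin k → Fin n) × (Fin k → Fin n) =>
    listWord s (List.ofFn p.1) * star (listWord s (List.ofFn p.2)))

theorem sum_listWord_cons {M : Type*} [AddCommMonoid M] {k : ℕ} (f : List (Fin n) → M) :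
    ∑ μ : Fin (k + 1) → Fin n, f (List.ofFn μ) =
      ∑ i : Fin n, ∑ μ : Fin k → Fin n, f (i :: List.ofFn μ) := by
  rw [← (Fin.consEquiv fun _ => Fin n).sum_comp, Fintype.sum_prod_type]
  simp [Fin.consEquiv]

theorem IsCuntzTuple.star_listWord_mul_listWord (hs : IsCuntzTuple s) {μ ν : List (Fin n)}
    (h : μ.length = ν.length) :
    star (listWord s μ) * listWord s ν = if μ = ν then 1 else 0 := by
  induction μ generalizing ν with
  | nil =>
    obtain rfl : ν = [] := by simpa using h.symm
    simp
  | cons i μ ih =>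
    cases ν with
    | nil => simp at h
    | cons j ν =>
      rw [listWord_cons, listWord_cons, star_mul, mul_assoc, hs.star_gen_mul_gen_mul]
      by_cases hij : i = j
      · simp [hij, ih (by simpa using h)]
      · simp [hij]

theorem IsCuntzTuple.star_ofFn_mul_ofFn (hs : IsCuntzTuple s) {k : ℕ} (μ ν : Fin k → Fin n) :
    star (listWord s (List.ofFn μ)) * listWord s (List.ofFn ν) = if μ = ν then 1 else 0 := by
  rw [hs.star_listWord_mul_listWord (by simp)]
  simp

theorem IsCuntzTuple.endo_pow_apply (hs : IsCuntzTuple s) (k : ℕ) (x : A) :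
    (hs.endo ^ k) x = ∑ μ : Fin k → Fin n,
      listWord s (List.ofFn μ) * x * star (listWord s (List.ofFn μ)) := by
  induction k with
  | zero => simp; rfl
  | succ k ih =>
    rw [hs.endo_pow_succ_apply, ih, hs.endo_apply,
      sum_listWord_cons fun l => listWord s l * x * star (listWord s l)]
    simp [Finset.mul_sum, Finset.sum_mul, mul_assoc]

theorem linv_pow_apply (s : Fin n → A) (k : ℕ) (x : A) :
    (linv s ^ k) x = ((n : ℂ)⁻¹ ^ k) • ∑ μ : Fin k → Fin n,
      star (listWord s (List.ofFn μ)) * x * listWord s (List.ofFn μ) := by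
  induction k generalizing x with
  | zero => simp
  | succ k ih =>
    rw [pow_succ, Module.End.mul_apply, ih, linv_apply,
      sum_listWord_cons fun l => star (listWord s l) * x * listWord s l, Finset.sum_comm]
    simp [Finset.mul_sum, Finset.sum_mul, mul_assoc, pow_succ, mul_smul, Finset.smul_sum]

/-- A functional that is tracial against all levels is invariant under `Φ^k ∘ Ψ^k`: the latter is
the average of the maps `x ↦ e x e^*` over the matrix units `e` of level `k`. -/
theorem apply_endo_pow_linv_pow [Nontrivial A] (hs : IsCuntzTuple s) (f : A →ₗ[ℂ] ℂ)
    (hf : ∀ k, ∀ a, ∀ b ∈ levelSpan s k, f (a * b) = f (b * a)) (k : ℕ) (x : A) :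
    f ((hs.endo ^ k) ((linv s ^ k) x)) = f x := by
  have hone := hs.endo_pow_apply k 1
  rw [map_one] at hone
  have hterm : ∀ μ ν : Fin k → Fin n,
      f (listWord s (List.ofFn μ) * (star (listWord s (List.ofFn ν)) * x *
        listWord s (List.ofFn ν)) * star (listWord s (List.ofFn μ))) =
      f (x * (listWord s (List.ofFn ν) * 1 * star (listWord s (List.ofFn ν)))) := by
    intro μ ν
    have h := hf k (x * (listWord s (List.ofFn ν) * star (listWord s (List.ofFn μ))))
      (listWord s (List.ofFn μ) * star (listWord s (List.ofFn ν)))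
      (Submodule.subset_span ⟨(μ, ν), rfl⟩)
    have h1 : star (listWord s (List.ofFn μ)) * listWord s (List.ofFn μ) = 1 := by
      simp [hs.star_ofFn_mul_ofFn]
    calc _ = f (listWord s (List.ofFn μ) * star (listWord s (List.ofFn ν)) *
        (x * (listWord s (List.ofFn ν) * star (listWord s (List.ofFn μ))))) := by
          simp only [mul_assoc]
      _ = f (x * (listWord s (List.ofFn ν) * (star (listWord s (List.ofFn μ)) *
          listWord s (List.ofFn μ)) * star (listWord s (List.ofFn ν)))) := by
          rw [← h]; simp only [mul_assoc]
      _ = _ := by rw [h1]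
  have hsum : ∑ ν : Fin k → Fin n,
      f (x * (listWord s (List.ofFn ν) * 1 * star (listWord s (List.ofFn ν)))) = f x := by
    rw [← map_sum, ← Finset.mul_sum, ← hone, mul_one]
  rw [hs.endo_pow_apply, linv_pow_apply]
  simp only [mul_smul_comm, smul_mul_assoc, Finset.mul_sum, Finset.sum_mul, ← Finset.smul_sum,
    map_smul, map_sum, hterm, hsum]
  simp [hs.natCast_ne_zero]

variable [Nontrivial A] (hs : IsCuntzTuple s) (hg : TopGenerates s) (hn : 2 ≤ n)

theorem eq_limitFunctional_of_trace (f : A →ₗ[ℂ] ℂ) (hc : Continuous f) (h1 : f 1 = 1)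
    (hf : ∀ k, ∀ a, ∀ b ∈ levelSpan s k, f (a * b) = f (b * a)) (x : A) :
    f x = limitFunctional hs hg hn x := by
  set c := limitFunctional hs hg hn x
  have h2 : Tendsto (fun k => (hs.endo ^ k) ((linv s ^ k) x)) atTop (𝓝 (c • (1 : A))) := by
    rw [tendsto_iff_norm_sub_tendsto_zero]
    refine squeeze_zero (fun _ => norm_nonneg _) (fun k => ?_)
      (tendsto_iff_norm_sub_tendsto_zero.1 (tendsto_limitFunctional hs hg hn x))
    have := hs.norm_endo_pow_le k ((linv s ^ k) x - c • 1)
    rwa [map_sub, map_smul, map_one] at this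
  have h3 := (hc.tendsto _).comp h2
  simp only [Function.comp_def, apply_endo_pow_linv_pow hs f hf, map_smul, h1] at h3
  simpa using tendsto_nhds_unique tendsto_const_nhds h3

theorem limitFunctional_mul_monomial {μ ν : List (Fin n)} (h : μ.length = ν.length) (a : A) :
    limitFunctional hs hg hn (a * (listWord s μ * star (listWord s ν))) =
      limitFunctional hs hg hn (listWord s μ * star (listWord s ν) * a) := by
  induction μ generalizing ν a with
  | nil =>
    obtain rfl : ν = [] := by simpa using h.symm
    simp
  | cons i μ ih =>
    cases ν with
    | nil => simp at h
    | cons j ν =>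
      calc _ = limitFunctional hs hg hn
            ((a * (s i * (listWord s μ * star (listWord s ν)))) * star (s j)) := by
            simp [mul_assoc]
        _ = (n : ℂ)⁻¹ * limitFunctional hs hg hn
            ((star (s j) * a * s i) * (listWord s μ * star (listWord s ν))) := by
            rw [limitFunctional_mul_star_gen]; simp only [mul_assoc]
        _ = (n : ℂ)⁻¹ * limitFunctional hs hg hn
            ((listWord s μ * star (listWord s ν) * (star (s j) * a)) * s i) := by
            rw [ih (by simpa using h)]; simp only [mul_assoc]
        _ = _ := by rw [← limitFunctional_gen_mul]; simp [mul_assoc]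

theorem limitFunctional_trace (a : A) {b : A} (hb : b ∈ closure (⋃ k, (levelSpan s k : Set A))) :
    limitFunctional hs hg hn (a * b) = limitFunctional hs hg hn (b * a) := by
  have hc := continuous_limitFunctional hs hg hn
  refine closure_minimal (t := {b | limitFunctional hs hg hn (a * b) =
    limitFunctional hs hg hn (b * a)}) ?_ ?_ hb
  · refine Set.iUnion_subset fun k b hb => ?_
    have h := (Submodule.span_le (p := LinearMap.ker (limitFunctional hs hg hn ∘ₗ
      (LinearMap.mulLeft ℂ a - LinearMap.mulRight ℂ a)))).2 (by
        rintro _ ⟨⟨μ, ν⟩, rfl⟩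
        have := limitFunctional_mul_monomial hs hg hn (μ := List.ofFn μ) (ν := List.ofFn ν)
          (by simp) a
        simp [this]) hb
    exact sub_eq_zero.1 (by simpa using h)
  · exact isClosed_eq (hc.comp (by fun_prop)) (hc.comp (by fun_prop))

/-- The left kernel of `φ` is two-sided, by the relations `φ(s_i x) = φ(x s_i) / n` and
`φ(x s_i^*) = φ(s_i^* x) / n`. -/
theorem limitFunctional_mul_mul_eq_zero {z : A} (hz : ∀ x, limitFunctional hs hg hn (z * x) = 0)
    (y x : A) : limitFunctional hs hg hn (y * z * x) = 0 := by
  have hc := continuous_limitFunctional hs hg hn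
  let V : Submodule ℂ A :=
    { carrier := {y | ∀ x, limitFunctional hs hg hn (y * z * x) = 0}
      zero_mem' := by simp
      add_mem' := fun {a b} ha hb x => by simp [add_mul, ha x, hb x]
      smul_mem' := fun c a ha x => by simp [ha x] }
  have hV : IsClosed (V : Set A) := by
    have : (V : Set A) = ⋂ x, {y | limitFunctional hs hg hn (y * z * x) = 0} := by
      ext; simp [V]
    rw [this]
    exact isClosed_iInter fun x => isClosed_eq (hc.comp (by fun_prop)) continuous_const
  refine hg.mem_of_left_stable V hV (fun x => by simpa using hz x) ?_ ?_ y x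
  · intro i y hy x
    calc _ = limitFunctional hs hg hn (s i * (y * z * x)) := by simp only [mul_assoc]
      _ = 0 := by rw [limitFunctional_gen_mul, mul_assoc, hy, mul_zero]
  · intro i y hy x
    have h := limitFunctional_mul_star_gen hs hg hn i (y * z * x)
    rw [mul_assoc, hy, eq_comm, mul_eq_zero] at h
    have h' := h.resolve_left (inv_ne_zero hs.natCast_ne_zero)
    simpa only [mul_assoc] using h'

end

section

variable {n : ℕ} {A : Type*} [CStarAlgebra A] {s : Fin n → A}

/-! ### The levels as matrix algebras -/

theorem mem_levelSpan_of_length {k : ℕ} {μ ν : List (Fin n)} (hμ : μ.length = k)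
    (hν : ν.length = k) : listWord s μ * star (listWord s ν) ∈ levelSpan s k := by
  subst hμ
  refine Submodule.subset_span ⟨(μ.get, fun i => ν.get (i.cast hν.symm)), ?_⟩
  have h : List.ofFn (fun i => ν.get (i.cast hν.symm)) = ν := by
    apply List.ext_get <;> simp [hν]
  simp only [h, List.ofFn_get]

theorem IsCuntzTuple.monotone_levelSpan (hs : IsCuntzTuple s) : Monotone (levelSpan s) := by
  refine monotone_nat_of_le_succ fun k => Submodule.span_le.2 ?_
  rintro _ ⟨⟨μ, ν⟩, rfl⟩
  have h : listWord s (List.ofFn μ) * star (listWord s (List.ofFn ν)) =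
      ∑ i, listWord s (List.ofFn μ ++ [i]) * star (listWord s (List.ofFn ν ++ [i])) := by
    calc _ = listWord s (List.ofFn μ) * (∑ i, s i * star (s i)) *
        star (listWord s (List.ofFn ν)) := by rw [hs.sum_mul_star, mul_one]
      _ = _ := by
        rw [Finset.mul_sum, Finset.sum_mul]
        exact Finset.sum_congr rfl fun i _ => by simp [listWord_append, mul_assoc]
  simp only [SetLike.mem_coe]
  rw [h]
  exact Submodule.sum_mem _ fun i _ => mem_levelSpan_of_length (by simp) (by simp)

/-- The column isometry `ξ ↦ ∑ ξ_μ s_μ` on words of length `k`. -/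
noncomputable def wordVec (s : Fin n → A) {k : ℕ} (ξ : EuclideanSpace ℂ (Fin k → Fin n)) : A :=
  ∑ μ, ξ μ • listWord s (List.ofFn μ)

theorem IsCuntzTuple.star_wordVec_mul_wordVec (hs : IsCuntzTuple s) {k : ℕ}
    (ξ η : EuclideanSpace ℂ (Fin k → Fin n)) :
    star (wordVec s ξ) * wordVec s η = (inner ℂ ξ η : ℂ) • (1 : A) := by
  simp [wordVec, Finset.sum_mul, Finset.mul_sum, hs.star_ofFn_mul_ofFn, PiLp.inner_apply,
    Finset.sum_smul, smul_smul]

theorem IsCuntzTuple.norm_wordVec [Nontrivial A] (hs : IsCuntzTuple s) {k : ℕ}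
    (ξ : EuclideanSpace ℂ (Fin k → Fin n)) : ‖wordVec s ξ‖ = ‖ξ‖ := by
  have h : ‖wordVec s ξ‖ * ‖wordVec s ξ‖ = ‖ξ‖ * ‖ξ‖ := by
    rw [← CStarRing.norm_star_mul_self, hs.star_wordVec_mul_wordVec, norm_smul, norm_one, mul_one,
      inner_self_eq_norm_sq_to_K]
    simp [sq]
  exact (mul_self_inj (norm_nonneg _) (norm_nonneg _)).1 h

open scoped Matrix.Norms.L2Operator

/-- The level `k` as the image of the matrix algebra `M_{n^k}` under the `*`-homomorphism that
sends the matrix units to `s_μ s_ν^*`. -/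
noncomputable def IsCuntzTuple.matrixHom (hs : IsCuntzTuple s) (k : ℕ) :
    Matrix (Fin k → Fin n) (Fin k → Fin n) ℂ →⋆ₙₐ[ℂ] A where
  toFun B := ∑ μ, ∑ ν, B μ ν • (listWord s (List.ofFn μ) * star (listWord s (List.ofFn ν)))
  map_smul' c B := by simp [Finset.smul_sum, smul_smul]
  map_zero' := by simp
  map_add' B C := by simp [add_smul, Finset.sum_add_distrib]
  map_mul' B C := by
    have h : ∀ μ ν κ κ' : Fin k → Fin n,
        listWord s (List.ofFn μ) * star (listWord s (List.ofFn κ)) *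
          (listWord s (List.ofFn κ') * star (listWord s (List.ofFn ν))) =
        if κ = κ' then listWord s (List.ofFn μ) * star (listWord s (List.ofFn ν)) else 0 := by
      intro μ ν κ κ'
      rw [mul_assoc, ← mul_assoc (star _), hs.star_ofFn_mul_ofFn]
      split_ifs <;> simp
    simp only [Finset.sum_mul, Finset.mul_sum, smul_mul_smul_comm, h, smul_ite, smul_zero,
      Matrix.mul_apply, Finset.sum_smul]
    simp only [Finset.sum_ite_eq', Finset.mem_univ, if_true]
    rw [Finset.sum_congr rfl fun μ _ => Finset.sum_comm, Finset.sum_comm]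
    exact Finset.sum_congr rfl fun κ _ => Finset.sum_comm
  map_star' B := by
    simp only [star_sum, star_smul, star_mul, star_star, Matrix.star_apply]
    rw [Finset.sum_comm]

theorem IsCuntzTuple.matrixHom_apply (hs : IsCuntzTuple s) (k : ℕ)
    (B : Matrix (Fin k → Fin n) (Fin k → Fin n) ℂ) : hs.matrixHom k B =
    ∑ μ, ∑ ν, B μ ν • (listWord s (List.ofFn μ) * star (listWord s (List.ofFn ν))) := rfl

theorem IsCuntzTuple.exists_matrixHom_eq (hs : IsCuntzTuple s) {k : ℕ} {b : A}
    (hb : b ∈ levelSpan s k) : ∃ B, hs.matrixHom k B = b := by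
  induction hb using Submodule.span_induction with
  | mem x hx =>
    obtain ⟨⟨μ, ν⟩, rfl⟩ := hx
    refine ⟨Matrix.single μ ν 1, ?_⟩
    rw [hs.matrixHom_apply, Finset.sum_eq_single μ, Finset.sum_eq_single ν]
    · simp
    · intro κ _ h
      simp [h.symm]
    · simp
    · intro κ _ h
      simp [h.symm]
    · simp
  | zero => exact ⟨0, map_zero _⟩
  | add x y _ _ hx hy =>
    obtain ⟨B, rfl⟩ := hx
    obtain ⟨C, rfl⟩ := hy
    exact ⟨B + C, map_add _ _ _⟩
  | smul c x _ hx =>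
    obtain ⟨B, rfl⟩ := hx
    exact ⟨c • B, map_smul _ _ _⟩

theorem IsCuntzTuple.matrixHom_mul_wordVec (hs : IsCuntzTuple s) {k : ℕ}
    (B : Matrix (Fin k → Fin n) (Fin k → Fin n) ℂ) (η : EuclideanSpace ℂ (Fin k → Fin n)) :
    hs.matrixHom k B * wordVec s η = wordVec s (Matrix.toEuclideanCLM (𝕜 := ℂ) B η) := by
  simp [hs.matrixHom_apply, wordVec, Finset.sum_mul, Finset.mul_sum, mul_assoc,
    hs.star_ofFn_mul_ofFn, Matrix.mulVec, dotProduct, Finset.sum_smul]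
  simp only [Finset.smul_sum, smul_smul]
  rw [Finset.sum_comm]
  simp only [mul_comm]

variable [Nontrivial A] (hs : IsCuntzTuple s) (hg : TopGenerates s) (hn : 2 ≤ n)

/-- The levels are simple: the kernel of `φ` does not come closer to an element `b` of a level than
`0` does. -/
theorem norm_le_norm_sub_of_kernel {k : ℕ} {b z : A} (hb : b ∈ levelSpan s k)
    (hz : ∀ x y, limitFunctional hs hg hn (x * z * y) = 0) : ‖b‖ ≤ ‖b - z‖ := by
  obtain ⟨B, rfl⟩ := hs.exists_matrixHom_eq hb
  refine (NonUnitalStarAlgHom.norm_apply_le (hs.matrixHom k) B).trans ?_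
  rw [Matrix.cstar_norm_def]
  refine ContinuousLinearMap.opNorm_le_bound _ (norm_nonneg _) fun η => ?_
  set ζ := Matrix.toEuclideanCLM (𝕜 := ℂ) B η
  -- Compressing to the columns of `ζ = B η` and `η` kills `z` and leaves the scalar `⟨ζ, B η⟩`.
  have h1 : limitFunctional hs hg hn
      (star (wordVec s ζ) * (hs.matrixHom k B - z) * wordVec s η) = (‖ζ‖ : ℂ) ^ 2 := by
    rw [mul_sub, sub_mul, map_sub, hz, sub_zero, mul_assoc, hs.matrixHom_mul_wordVec,
      hs.star_wordVec_mul_wordVec, map_smul, limitFunctional_one, inner_self_eq_norm_sq_to_K]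
    simp
  have h2 : ‖ζ‖ ^ 2 ≤ ‖ζ‖ * ‖hs.matrixHom k B - z‖ * ‖η‖ := by
    calc ‖ζ‖ ^ 2 = ‖limitFunctional hs hg hn
          (star (wordVec s ζ) * (hs.matrixHom k B - z) * wordVec s η)‖ := by rw [h1]; simp
      _ ≤ ‖star (wordVec s ζ) * (hs.matrixHom k B - z) * wordVec s η‖ :=
          norm_limitFunctional_le hs hg hn _
      _ ≤ ‖star (wordVec s ζ)‖ * ‖hs.matrixHom k B - z‖ * ‖wordVec s η‖ := norm_mul₃_le
      _ = _ := by rw [norm_star, hs.norm_wordVec, hs.norm_wordVec]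
  rcases (norm_nonneg ζ).eq_or_lt with h0 | h0
  · rw [← h0]; positivity
  · refine le_of_mul_le_mul_left ?_ h0
    linarith

end

section

variable {n : ℕ} {A : Type*} [CStarAlgebra A] {s : Fin n → A}

/-! ### Approximately central isometries -/

theorem IsCuntzTuple.endo_pow_mul_listWord (hs : IsCuntzTuple s) (a : ℕ) (l : List (Fin n))
    (x : A) : (hs.endo ^ (a + l.length)) x * listWord s l = listWord s l * (hs.endo ^ a) x := by
  induction l with
  | nil => simp
  | cons i l ih =>
    rw [List.length_cons, ← add_assoc, hs.endo_pow_succ_apply, listWord_cons, ← mul_assoc,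
      hs.endo_mul_gen, mul_assoc, ih, mul_assoc]

theorem IsCuntzTuple.star_gen_pow_mul_endo_pow (hs : IsCuntzTuple s) (j : Fin n) (e : ℕ) (x : A) :
    star (s j) ^ e * (hs.endo ^ e) x = x * star (s j) ^ e := by
  induction e with
  | zero => simp; rfl
  | succ e ih =>
    rw [hs.endo_pow_succ_apply, pow_succ, mul_assoc, hs.star_gen_mul_endo, ← mul_assoc, ih,
      mul_assoc]

/-- The isometry `s_i s_j^N`; for `i ≠ j` its word does not overlap with its own shifts. -/
noncomputable def probe (s : Fin n → A) (i j : Fin n) (N : ℕ) : A := s i * s j ^ N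

theorem IsCuntzTuple.star_gen_pow_mul_gen_pow (hs : IsCuntzTuple s) (j : Fin n) (N : ℕ) :
    star (s j) ^ N * s j ^ N = 1 := by
  induction N with
  | zero => simp
  | succ N ih =>
    rw [pow_succ, pow_succ', mul_assoc, ← mul_assoc (star (s j)), hs.star_mul_self, one_mul, ih]

theorem IsCuntzTuple.star_probe_mul_probe (hs : IsCuntzTuple s) (i j : Fin n) (N : ℕ) :
    star (probe s i j N) * probe s i j N = 1 := by
  rw [probe, star_mul, star_pow, mul_assoc, ← mul_assoc (star (s i)), hs.star_mul_self, one_mul,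
    hs.star_gen_pow_mul_gen_pow]

theorem IsCuntzTuple.star_probe_mul_endo_pow (hs : IsCuntzTuple s) {i j : Fin n} (hij : i ≠ j)
    {d N : ℕ} (hd : d ≠ 0) (hdN : d ≤ N) :
    star (probe s i j N) * (hs.endo ^ d) (probe s i j N) = 0 := by
  -- `s_i^*` absorbs one shift and `(s_j^*)^e` the others; the next `s_j^*` meets the leading `s_i`.
  obtain ⟨e, rfl⟩ := Nat.exists_eq_succ_of_ne_zero hd
  obtain ⟨c, rfl⟩ := Nat.exists_eq_add_of_le hdN
  generalize hv : probe s i j (e.succ + c) = v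
  have h0 : star (s j) * v = 0 := by
    rw [← hv, probe, hs.star_gen_mul_gen_mul, if_neg hij.symm]
  have hv' : star v = star (s j) ^ c * (star (s j) * star (s j) ^ e) * star (s i) := by
    rw [← hv, probe, star_mul, star_pow, ← pow_succ', ← pow_add, add_comm c]
  calc _ = star (s j) ^ c * (star (s j) * (star (s j) ^ e * (hs.endo ^ e) v)) * star (s i) := by
        rw [hv', Nat.succ_eq_add_one, hs.endo_pow_succ_apply, mul_assoc, hs.star_gen_mul_endo]
        simp only [mul_assoc]
    _ = star (s j) ^ c * ((star (s j) * v) * star (s j) ^ e) * star (s i) := by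
        rw [hs.star_gen_pow_mul_endo_pow, mul_assoc (star (s j)) v]
    _ = 0 := by simp [h0]

theorem IsCuntzTuple.star_shift_mul_shift_add (hs : IsCuntzTuple s) (a d : ℕ) (v : A) :
    star ((hs.endo ^ a) v) * (hs.endo ^ (a + d)) v =
      (hs.endo ^ a) (star v * (hs.endo ^ d) v) := by
  rw [map_mul, map_star, pow_add]; rfl

/-- The shifts `Φ^k(s_i s_j^N)`, `k ≤ N`, are isometries with orthogonal ranges. -/
theorem IsCuntzTuple.star_shift_mul_shift (hs : IsCuntzTuple s) {i j : Fin n} (hij : i ≠ j)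
    {k l N : ℕ} (hk : k ≤ N) (hl : l ≤ N) :
    star ((hs.endo ^ k) (probe s i j N)) * (hs.endo ^ l) (probe s i j N) =
      if k = l then 1 else 0 := by
  have key : ∀ a d, a + d ≤ N → star ((hs.endo ^ a) (probe s i j N)) *
      (hs.endo ^ (a + d)) (probe s i j N) = if d = 0 then 1 else 0 := by
    intro a d h
    rw [hs.star_shift_mul_shift_add]
    split_ifs with hd
    · subst hd
      have : (hs.endo ^ 0) (probe s i j N) = probe s i j N := by rw [pow_zero]; rfl
      rw [this, hs.star_probe_mul_probe, map_one]
    · rw [hs.star_probe_mul_endo_pow hij hd (by omega), map_zero]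
  rcases le_total k l with h | h
  · obtain ⟨d, rfl⟩ := Nat.exists_eq_add_of_le h
    rw [key k d hl]
    simp
  · obtain ⟨d, rfl⟩ := Nat.exists_eq_add_of_le h
    have := congrArg star (key l d hk)
    rw [star_mul, star_star] at this
    rw [this]
    split_ifs <;> simp_all

theorem IsCuntzTuple.norm_shift_le [Nontrivial A] (hs : IsCuntzTuple s) (i j : Fin n) (k N : ℕ) :
    ‖(hs.endo ^ k) (probe s i j N)‖ ≤ 1 := by
  refine (hs.norm_endo_pow_le k _).trans ?_
  have h : ‖probe s i j N‖ * ‖probe s i j N‖ = 1 := by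
    rw [← CStarRing.norm_star_mul_self, hs.star_probe_mul_probe, norm_one]
  nlinarith [norm_nonneg (probe s i j N)]

/-- The compression by a sufficiently shifted probe maps a monomial into the levels: it keeps the
monomials `s_μ s_ν^*` with `|μ| = |ν|` and kills the others. -/
theorem IsCuntzTuple.star_shift_mul_monomial_mul_shift (hs : IsCuntzTuple s) {i j : Fin n}
    (hij : i ≠ j) (μ ν : List (Fin n)) {k N : ℕ} (hμ : μ.length ≤ k) (hν : ν.length ≤ k)
    (hk : k ≤ N) :
    star ((hs.endo ^ k) (probe s i j N)) * (listWord s μ * star (listWord s ν)) *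
      (hs.endo ^ k) (probe s i j N) =
      if μ.length = ν.length then listWord s μ * star (listWord s ν) else 0 := by
  generalize hv : probe s i j N = v
  obtain ⟨a, ha⟩ := Nat.exists_eq_add_of_le' hμ
  obtain ⟨b, hb⟩ := Nat.exists_eq_add_of_le' hν
  have h1 : star ((hs.endo ^ k) v) * listWord s μ = listWord s μ * star ((hs.endo ^ a) v) := by
    rw [← map_star, ← map_star, ha, hs.endo_pow_mul_listWord]
  have h2 : star (listWord s ν) * (hs.endo ^ k) v = (hs.endo ^ b) v * star (listWord s ν) := by
    have := congrArg star (hs.endo_pow_mul_listWord b ν (star v))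
    rw [← hb] at this
    simpa [map_star] using this
  have h3 : star ((hs.endo ^ a) v) * (hs.endo ^ b) v = if a = b then 1 else 0 := by
    rw [← hv]; exact hs.star_shift_mul_shift hij (by omega) (by omega)
  calc _ = listWord s μ * (star ((hs.endo ^ a) v) * (hs.endo ^ b) v) * star (listWord s ν) := by
        rw [← mul_assoc, h1, mul_assoc, mul_assoc, h2]; simp only [mul_assoc]
    _ = _ := by
        rw [h3]
        have : a = b ↔ μ.length = ν.length := by omega
        simp only [this]
        split_ifs <;> simp

theorem IsCuntzTuple.exists_compression_mem_levelSpan (hs : IsCuntzTuple s) {i j : Fin n}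
    (hij : i ≠ j) {p : A} (hp : p ∈ monomialSpan s) :
    ∃ K, ∀ k ≥ K, ∀ N ≥ k, ∃ m,
      star ((hs.endo ^ k) (probe s i j N)) * p * (hs.endo ^ k) (probe s i j N) ∈
        levelSpan s m := by
  induction hp using Submodule.span_induction with
  | mem x hx =>
    obtain ⟨⟨μ, ν⟩, rfl⟩ := hx
    refine ⟨max μ.length ν.length, fun k hk N hN => ⟨μ.length, ?_⟩⟩
    rw [hs.star_shift_mul_monomial_mul_shift hij μ ν (by omega) (by omega) hN]
    split_ifs with h
    · exact mem_levelSpan_of_length rfl h.symm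
    · exact Submodule.zero_mem _
  | zero => exact ⟨0, fun k _ N _ => ⟨0, by simp⟩⟩
  | add x y _ _ hx hy =>
    obtain ⟨K, hK⟩ := hx
    obtain ⟨L, hL⟩ := hy
    refine ⟨max K L, fun k hk N hN => ?_⟩
    obtain ⟨m, hm⟩ := hK k (by omega) N hN
    obtain ⟨m', hm'⟩ := hL k (by omega) N hN
    refine ⟨max m m', ?_⟩
    rw [mul_add, add_mul]
    exact Submodule.add_mem _ (hs.monotone_levelSpan (le_max_left _ _) hm)
      (hs.monotone_levelSpan (le_max_right _ _) hm')
  | smul c x _ hx =>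
    obtain ⟨K, hK⟩ := hx
    refine ⟨K, fun k hk N hN => ?_⟩
    obtain ⟨m, hm⟩ := hK k hk N hN
    refine ⟨m, ?_⟩
    rw [mul_smul_comm, smul_mul_assoc]
    exact Submodule.smul_mem _ _ hm

/-- The normalized average of `m + 1` consecutive shifts of a probe. -/
noncomputable def IsCuntzTuple.shiftMean (hs : IsCuntzTuple s) (i j : Fin n) (K N m : ℕ) : A :=
  ((Real.sqrt (m + 1))⁻¹ : ℂ) • ∑ k ∈ Finset.range (m + 1), (hs.endo ^ (K + k)) (probe s i j N)

theorem IsCuntzTuple.star_shiftMean_mul_shiftMean (hs : IsCuntzTuple s) {i j : Fin n}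
    (hij : i ≠ j) {K N m : ℕ} (h : K + m ≤ N) :
    star (hs.shiftMean i j K N m) * hs.shiftMean i j K N m = 1 := by
  have h1 : star (∑ k ∈ Finset.range (m + 1), (hs.endo ^ (K + k)) (probe s i j N)) *
      ∑ k ∈ Finset.range (m + 1), (hs.endo ^ (K + k)) (probe s i j N) =
      ((m + 1 : ℕ) : ℂ) • (1 : A) := by
    rw [star_sum, Finset.sum_mul_sum]
    have : ∀ k ∈ Finset.range (m + 1), ∑ l ∈ Finset.range (m + 1),
        star ((hs.endo ^ (K + k)) (probe s i j N)) * (hs.endo ^ (K + l)) (probe s i j N) = 1 := by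
      intro k hk
      rw [Finset.mem_range] at hk
      rw [Finset.sum_eq_single k]
      · rw [hs.star_shift_mul_shift hij (by omega) (by omega), if_pos rfl]
      · intro l hl hlk
        rw [Finset.mem_range] at hl
        rw [hs.star_shift_mul_shift hij (by omega) (by omega), if_neg (by omega)]
      · simp [hk]
    rw [Finset.sum_congr rfl this]
    simp [← Nat.cast_smul_eq_nsmul ℂ, add_smul]
  have h2 : (Real.sqrt (m + 1) : ℂ) * Real.sqrt (m + 1) = m + 1 := by
    exact_mod_cast Real.mul_self_sqrt (by positivity : (0 : ℝ) ≤ m + 1)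
  have h3 : (m + 1 : ℂ) ≠ 0 := by exact_mod_cast m.succ_ne_zero
  rw [shiftMean, star_smul, smul_mul_smul_comm, h1, smul_smul, star_inv₀, Complex.star_def,
    Complex.conj_ofReal, ← mul_inv, h2]
  simp [h3]

/-- Consecutive shifts telescope. -/
theorem IsCuntzTuple.norm_endo_shiftMean_sub_le [Nontrivial A] (hs : IsCuntzTuple s) (i j : Fin n)
    (K N m : ℕ) : ‖hs.endo (hs.shiftMean i j K N m) - hs.shiftMean i j K N m‖ ≤
      2 / Real.sqrt (m + 1) := by
  have h : hs.endo (hs.shiftMean i j K N m) - hs.shiftMean i j K N m =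
      ((Real.sqrt (m + 1))⁻¹ : ℂ) • ((hs.endo ^ (K + (m + 1))) (probe s i j N) -
        (hs.endo ^ (K + 0)) (probe s i j N)) := by
    rw [← Finset.sum_range_sub fun k => (hs.endo ^ (K + k)) (probe s i j N),
      Finset.sum_sub_distrib, smul_sub, shiftMean, map_smul, map_sum]
    simp only [← add_assoc, hs.endo_pow_succ_apply]
  rw [h, norm_smul]
  have h1 := (norm_sub_le ((hs.endo ^ (K + (m + 1))) (probe s i j N))
    ((hs.endo ^ (K + 0)) (probe s i j N))).trans
    (add_le_add (hs.norm_shift_le i j _ N) (hs.norm_shift_le i j _ N))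
  calc _ ≤ ‖((Real.sqrt (m + 1))⁻¹ : ℂ)‖ * (1 + 1) := by gcongr
    _ = _ := by
      rw [norm_inv, Complex.norm_real, Real.norm_of_nonneg (Real.sqrt_nonneg _)]
      ring

/-- A bounded sequence that is asymptotically fixed by `Φ` is asymptotically central, since
`u s_i - s_i u = (u - Φ(u)) s_i`. -/
theorem IsCuntzTuple.tendsto_commutator [Nontrivial A] (hs : IsCuntzTuple s)
    (hg : TopGenerates s) {u : ℕ → A} (hu : ∀ m, ‖u m‖ ≤ 1)
    (h : Tendsto (fun m => hs.endo (u m) - u m) atTop (𝓝 0)) (x : A) :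
    Tendsto (fun m => x * u m - u m * x) atTop (𝓝 0) := by
  let V : Submodule ℂ A :=
    { carrier := {x | Tendsto (fun m => x * u m - u m * x) atTop (𝓝 0)}
      zero_mem' := by simp
      add_mem' := by
        intro x y hx hy
        have := hx.add hy
        simp only [add_zero] at this
        exact this.congr fun m => by simp only [add_mul, mul_add]; abel
      smul_mem' := by
        intro c x hx
        have := hx.const_smul c
        simp only [smul_zero] at this
        exact this.congr fun m => by simp only [smul_mul_assoc, mul_smul_comm, smul_sub] }
  have hV : IsClosed (V : Set A) := by
    refine isClosed_of_closure_subset fun x hx => Metric.tendsto_atTop.2 fun ε hε => ?_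
    obtain ⟨y, hy, hxy⟩ := Metric.mem_closure_iff.1 hx (ε / 4) (by positivity)
    obtain ⟨M, hM⟩ := Metric.tendsto_atTop.1 hy (ε / 2) (by positivity)
    refine ⟨M, fun m hm => ?_⟩
    have h1 := hM m hm
    rw [dist_zero_right] at h1 ⊢
    rw [dist_eq_norm] at hxy
    have h2 : x * u m - u m * x = (y * u m - u m * y) + (x - y) * u m - u m * (x - y) := by
      simp only [sub_mul, mul_sub]; abel
    have h3 : ‖(x - y) * u m‖ ≤ ‖x - y‖ * 1 := (norm_mul_le _ _).trans (by gcongr; exact hu m)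
    have h4 : ‖u m * (x - y)‖ ≤ 1 * ‖x - y‖ := (norm_mul_le _ _).trans (by gcongr; exact hu m)
    rw [h2]
    have h5 := norm_sub_le ((y * u m - u m * y) + (x - y) * u m) (u m * (x - y))
    have h6 := norm_add_le (y * u m - u m * y) ((x - y) * u m)
    linarith
  refine hg.mem_of_left_stable V hV (by simp [V]) ?_ ?_ x
  · intro i y hy
    have := (hy.const_mul (s i)).add (h.mul_const (s i * y))
    simp only [mul_zero, zero_mul, add_zero] at this
    refine this.congr fun m => ?_
    rw [sub_mul, ← mul_assoc (hs.endo (u m)), hs.endo_mul_gen]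
    simp only [mul_sub, mul_assoc]; abel
  · intro i y hy
    have := (hy.const_mul (star (s i))).sub ((h.const_mul (star (s i))).mul_const y)
    simp only [mul_zero, zero_mul, sub_zero] at this
    refine this.congr fun m => ?_
    rw [mul_sub (star (s i)) (hs.endo _), hs.star_gen_mul_endo]
    simp only [mul_sub, sub_mul, mul_assoc]; abel

/-! ### Nondegeneracy of the limit functional -/

variable [Nontrivial A] (hs : IsCuntzTuple s) (hg : TopGenerates s) (hn : 2 ≤ n)

/-- Far out compressions of the kernel of `φ` are close to the levels, hence small. -/
theorem exists_norm_mul_shift_le {i j : Fin n} (hij : i ≠ j) {z : A}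
    (hz : ∀ x y, limitFunctional hs hg hn (x * z * y) = 0) {ε : ℝ} (hε : 0 < ε) :
    ∃ K, ∀ k ≥ K, ∀ N ≥ k, ‖z * (hs.endo ^ k) (probe s i j N)‖ ≤ ε := by
  obtain ⟨p, hp, hzp⟩ := Metric.mem_closure_iff.1
    (mem_closure_monomialSpan hs hg (star z * z)) (ε ^ 2 / 2) (by positivity)
  obtain ⟨K, hK⟩ := hs.exists_compression_mem_levelSpan hij hp
  refine ⟨K, fun k hk N hN => ?_⟩
  obtain ⟨m, hm⟩ := hK k hk N hN
  set w := (hs.endo ^ k) (probe s i j N)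
  have hw : ‖w‖ ≤ 1 := hs.norm_shift_le i j k N
  have h1 := norm_le_norm_sub_of_kernel hs hg hn hm (z := star w * (star z * z) * w) fun x y => by
    rw [← hz (x * (star w * star z)) (w * y)]
    simp only [mul_assoc]
  have h2 : ‖star w * p * w - star w * (star z * z) * w‖ ≤ ε ^ 2 / 2 := by
    rw [← sub_mul, ← mul_sub]
    calc _ ≤ ‖star w‖ * ‖p - star z * z‖ * ‖w‖ := norm_mul₃_le
      _ ≤ 1 * ‖p - star z * z‖ * 1 := by rw [norm_star]; gcongr
      _ ≤ _ := by rw [one_mul, mul_one, ← dist_eq_norm, dist_comm]; exact hzp.le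
  -- `h1` and `h2` bound both `w^* p w` and its distance from `w^* z^* z w` by `ε ^ 2 / 2`.
  have h3 : ‖z * w‖ * ‖z * w‖ ≤ ε ^ 2 := by
    rw [← CStarRing.norm_star_mul_self, star_mul]
    have h4 : star w * star z * (z * w) = star w * (star z * z) * w := by simp only [mul_assoc]
    rw [h4]
    have := norm_sub_norm_le (star w * (star z * z) * w) (star w * p * w)
    rw [norm_sub_rev] at this
    linarith
  exact abs_le_of_sq_le_sq' (by rw [sq]; exact h3) hε.le |>.2

theorem eq_zero_of_kernel {z : A} (hz : ∀ x y, limitFunctional hs hg hn (x * z * y) = 0) :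
    z = 0 := by
  let i : Fin n := ⟨0, by omega⟩
  let j : Fin n := ⟨1, by omega⟩
  have hij : i ≠ j := by simp [i, j]
  -- For fixed `m` the mean is pushed out so far that each of its `m + 1` terms contributes at most
  -- `1 / (m + 1) ^ 2`.
  have hex : ∀ m : ℕ, ∃ K, ‖z * hs.shiftMean i j K (K + m) m‖ ≤ 1 / ((m : ℝ) + 1) := by
    intro m
    obtain ⟨K, hK⟩ := exists_norm_mul_shift_le hs hg hn hij hz
      (ε := 1 / ((m : ℝ) + 1) ^ 2) (by positivity)
    refine ⟨K, ?_⟩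
    have h1 : ‖z * ∑ k ∈ Finset.range (m + 1), (hs.endo ^ (K + k)) (probe s i j (K + m))‖ ≤
        ((m : ℝ) + 1) * (1 / ((m : ℝ) + 1) ^ 2) := by
      rw [Finset.mul_sum]
      refine (norm_sum_le_of_le (n := fun _ => 1 / ((m : ℝ) + 1) ^ 2) _ fun k hk => ?_).trans_eq
        (by simp)
      rw [Finset.mem_range] at hk
      exact hK _ (by omega) _ (by omega)
    have h2 : ‖((Real.sqrt (m + 1))⁻¹ : ℂ)‖ ≤ 1 := by
      rw [norm_inv, Complex.norm_real, Real.norm_of_nonneg (Real.sqrt_nonneg _)]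
      exact inv_le_one_of_one_le₀ (Real.one_le_sqrt.2 (by linarith [m.cast_nonneg (α := ℝ)]))
    rw [IsCuntzTuple.shiftMean, mul_smul_comm, norm_smul]
    calc _ ≤ 1 * (((m : ℝ) + 1) * (1 / ((m : ℝ) + 1) ^ 2)) := by gcongr
      _ = _ := by field_simp
  choose K hK using hex
  set u : ℕ → A := fun m => hs.shiftMean i j (K m) (K m + m) m
  have huu : ∀ m, star (u m) * u m = 1 := fun m => hs.star_shiftMean_mul_shiftMean hij le_rfl
  have hu : ∀ m, ‖u m‖ ≤ 1 := by
    intro m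
    have h : ‖u m‖ * ‖u m‖ = 1 := by rw [← CStarRing.norm_star_mul_self, huu, norm_one]
    nlinarith [norm_nonneg (u m)]
  have hfix : Tendsto (fun m => hs.endo (u m) - u m) atTop (𝓝 0) := by
    refine squeeze_zero_norm (fun m => hs.norm_endo_shiftMean_sub_le i j (K m) (K m + m) m) ?_
    exact (Real.tendsto_sqrt_atTop.comp
      (tendsto_atTop_add_const_right _ 1 tendsto_natCast_atTop_atTop)).const_div_atTop 2
  have hzu : Tendsto (fun m => z * u m) atTop (𝓝 0) :=
    squeeze_zero_norm hK tendsto_one_div_add_atTop_nhds_zero_nat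
  have huz : Tendsto (fun m => u m * z) atTop (𝓝 0) := by
    simpa using hzu.sub (hs.tendsto_commutator hg hu hfix z)
  have hnorm : ∀ m, ‖z‖ ≤ ‖u m * z‖ := by
    intro m
    calc ‖z‖ = ‖star (u m) * (u m * z)‖ := by rw [← mul_assoc, huu, one_mul]
      _ ≤ ‖star (u m)‖ * ‖u m * z‖ := norm_mul_le _ _
      _ ≤ 1 * ‖u m * z‖ := by rw [norm_star]; gcongr; exact hu m
      _ = _ := one_mul _
  have h0 := ge_of_tendsto' huz.norm hnorm
  simpa using h0

/-- Faithfulness of the inner product `⟨x, y⟩ = φ(y^* x)`. -/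
theorem eq_zero_of_limitFunctional_mul_eq_zero {z : A}
    (hz : ∀ x, limitFunctional hs hg hn (z * x) = 0) : z = 0 :=
  eq_zero_of_kernel hs hg hn (limitFunctional_mul_mul_eq_zero hs hg hn hz)

end

/-! ### Completely positive maps -/

theorem Ad_apply {B : Type*} [Ring B] [StarRing B] [Algebra ℂ B] (b x : B) :
    Ad b x = b * x * star b := by simp [Ad]

section

variable {A B : Type*} [CStarAlgebra A] [PartialOrder A] [StarOrderedRing A]
  [CStarAlgebra B] [PartialOrder B] [StarOrderedRing B]

theorem id_mem_cpMaps : (LinearMap.id : B →ₗ[ℂ] B) ∈ cpMaps B B :=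
  ⟨⟨LinearMap.id, fun _ _ hM => hM⟩, rfl⟩

theorem Ad_mem_cpMaps (b : B) : Ad b ∈ cpMaps B B := by
  refine ⟨⟨Ad b, fun k M hM => ?_⟩, rfl⟩
  let D : CStarMatrix (Fin k) (Fin k) B := CStarMatrix.ofMatrix (Matrix.diagonal fun _ => b)
  have h : M.map (Ad b) = D * M * star D := by
    ext i j
    have hD : ∀ i j, D i j = if i = j then b else 0 := fun i j => Matrix.diagonal_apply ..
    simp only [CStarMatrix.map_apply, Ad_apply, CStarMatrix.mul_apply, CStarMatrix.star_apply, hD]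
    simp [apply_ite star]
  rw [h]
  exact star_right_conjugate_nonneg hM D

theorem sum_mem_cpMaps {ι : Type*} [Fintype ι] {f : ι → (A →ₗ[ℂ] B)} (hf : ∀ i, f i ∈ cpMaps A B) :
    ∑ i, f i ∈ cpMaps A B := by
  choose g hg using hf
  refine ⟨⟨∑ i, f i, fun k M hM => ?_⟩, rfl⟩
  have h : M.map (∑ i, f i : A →ₗ[ℂ] B) = ∑ i, M.map (g i) := by
    ext a b
    have hs : ∀ N : ι → CStarMatrix (Fin k) (Fin k) B, (∑ i, N i) a b = ∑ i, N i a b :=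
      fun N => Matrix.sum_apply a b _ N
    rw [hs, CStarMatrix.map_apply, LinearMap.sum_apply]
    exact Finset.sum_congr rfl fun i _ => (LinearMap.congr_fun (hg i) (M a b)).symm
  change 0 ≤ M.map (∑ i, f i : A →ₗ[ℂ] B)
  rw [h]
  exact Finset.sum_nonneg fun i _ => (g i).map_cstarMatrix_nonneg' k M hM

/-- The order on `CStarMatrix` is defined from its non-unital C*-algebra structure; in this form the
fact applies to it directly. -/
theorem exists_star_mul_self_of_nonneg {C : Type*} [NonUnitalCStarAlgebra C] [PartialOrder C]
    [StarOrderedRing C] {x : C} (hx : 0 ≤ x) : ∃ y : C, x = star y * y :=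
  CStarAlgebra.nonneg_iff_eq_star_mul_self.1 hx

/-- The two-dimensional Gram form of complete positivity. -/
theorem exists_gram_of_mem_cpMaps {Θ : A →ₗ[ℂ] B} (hΘ : Θ ∈ cpMaps A B) (y : Fin 2 → A) :
    ∃ N : Fin 2 → Fin 2 → B, ∀ i j, Θ (star (y i) * y j) = ∑ k, star (N k i) * N k j := by
  obtain ⟨g, rfl⟩ := hΘ
  let R : CStarMatrix (Fin 2) (Fin 2) A :=
    CStarMatrix.ofMatrix (Matrix.of fun i j => if i = 0 then y j else 0)
  have hR : ∀ i j, R i j = if i = 0 then y j else 0 := fun _ _ => rfl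
  have h := g.map_cstarMatrix_nonneg' 2 (star R * R) (star_mul_self_nonneg R)
  obtain ⟨N, hN⟩ := exists_star_mul_self_of_nonneg h
  refine ⟨fun i j => N i j, fun i j => ?_⟩
  have := congrFun (congrFun hN i) j
  simpa [CStarMatrix.mul_apply, CStarMatrix.star_apply, hR] using this

theorem exists_gram_Ad_comp {Θ : A →ₗ[ℂ] B} (hΘ : Θ ∈ cpMaps A B) (a : B) (y : Fin 2 → A) :
    ∃ N : Fin 2 → Fin 2 → B,
      ∀ i j, (Ad a ∘ₗ Θ) (star (y i) * y j) = ∑ k, star (N k i) * N k j := by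
  obtain ⟨N, hN⟩ := exists_gram_of_mem_cpMaps hΘ y
  refine ⟨fun i j => N i j * star a, fun i j => ?_⟩
  rw [LinearMap.comp_apply, hN, Ad_apply, Finset.mul_sum, Finset.sum_mul]
  exact Finset.sum_congr rfl fun k _ => by simp [mul_assoc]

/-- If a `*`-homomorphism `π` is a sum of maps `Ad a_i ∘ Θ_i` with completely positive `Θ_i`, then
every summand is `Ψ_i(x) = Ψ_i(1) π(x)`, because the quadratic form of `π` vanishes at the column
`(1, -π(x))` and hence so do the Gram vectors of all summands. -/
theorem Ad_comp_eq_of_sum_eq_starAlgHom {m : ℕ} (π : A →⋆ₐ[ℂ] B) (a : Fin m → B)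
    (Θ : Fin m → (A →ₗ[ℂ] B)) (hΘ : ∀ i, Θ i ∈ cpMaps A B)
    (hsum : ∀ x, π x = ∑ i, (Ad (a i) ∘ₗ Θ i) x) (i : Fin m) (x : A) :
    (Ad (a i) ∘ₗ Θ i) x = (Ad (a i) ∘ₗ Θ i) 1 * π x := by
  choose N hN using fun i => exists_gram_Ad_comp (hΘ i) (a i) ![x, 1]
  set Ψ : Fin m → (A →ₗ[ℂ] B) := fun i => Ad (a i) ∘ₗ Θ i
  let c : Fin m → Fin 2 → B := fun i k => N i k 0 - N i k 1 * π x
  have h00 : ∀ i, Ψ i (star x * x) = ∑ k, star (N i k 0) * N i k 0 := fun i => hN i 0 0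
  have h01 : ∀ i, Ψ i (star x) = ∑ k, star (N i k 0) * N i k 1 := fun i => by
    simpa [Ψ] using hN i 0 1
  have h10 : ∀ i, Ψ i x = ∑ k, star (N i k 1) * N i k 0 := fun i => by simpa [Ψ] using hN i 1 0
  have h11 : ∀ i, Ψ i 1 = ∑ k, star (N i k 1) * N i k 1 := fun i => by simpa [Ψ] using hN i 1 1
  have hform : ∀ i, ∑ k, star (c i k) * c i k = Ψ i (star x * x) - Ψ i (star x) * π x -
      star (π x) * Ψ i x + star (π x) * Ψ i 1 * π x := by
    intro i
    rw [h00, h01, h10, h11]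
    simp only [Fin.sum_univ_two, c, star_sub, star_mul]
    noncomm_ring
  have hzero : ∑ i, ∑ k, star (c i k) * c i k = 0 := by
    simp only [hform, Finset.sum_add_distrib, Finset.sum_sub_distrib, ← Finset.mul_sum,
      ← Finset.sum_mul]
    have hsum' : ∀ x, ∑ i, Ψ i x = π x := fun x => (hsum x).symm
    simp [hsum', map_mul, map_star]
  have hi := (Finset.sum_eq_zero_iff_of_nonneg fun i _ =>
    Finset.sum_nonneg fun k _ => star_mul_self_nonneg (c i k)).1 hzero i (Finset.mem_univ i)
  have hc : ∀ k, c i k = 0 := fun k => (CStarRing.star_mul_self_eq_zero_iff _).1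
    ((Finset.sum_eq_zero_iff_of_nonneg fun k _ => star_mul_self_nonneg (c i k)).1 hi k
      (Finset.mem_univ k))
  have hc' : ∀ k, N i k 0 = N i k 1 * π x := fun k => sub_eq_zero.1 (hc k)
  change Ψ i x = Ψ i 1 * π x
  rw [h10, h11, Finset.sum_mul]
  exact Finset.sum_congr rfl fun k _ => by rw [hc' k, mul_assoc]

theorem star_Ad_comp {Θ : A →ₗ[ℂ] B} (hΘ : Θ ∈ cpMaps A B) (a : B) (x : A) :
    star ((Ad a ∘ₗ Θ) x) = (Ad a ∘ₗ Θ) (star x) := by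
  obtain ⟨N, hN⟩ := exists_gram_Ad_comp hΘ a ![x, 1]
  have h01 : (Ad a ∘ₗ Θ) (star x) = ∑ k, star (N k 0) * N k 1 := by simpa using hN 0 1
  have h10 : (Ad a ∘ₗ Θ) x = ∑ k, star (N k 1) * N k 0 := by simpa using hN 1 0
  rw [h01, h10]
  simp

end

section

variable {H : Type*} [NormedAddCommGroup H] [InnerProductSpace ℂ H] [CompleteSpace H]
  {B : StarSubalgebra ℂ (H →L[ℂ] H)} [IsClosed (B : Set (H →L[ℂ] H))]

/-- Every unital `*`-homomorphism is an operational extreme point among completely positive maps. -/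
theorem isOperationalExtremePoint_of_starAlgHom (π : B →⋆ₐ[ℂ] B) {Φ : B →ₗ[ℂ] B}
    (hΦ : ∀ x, Φ x = π x) (hcp : Φ ∈ cpMaps B B) :
    IsOperationalExtremePoint (cpMaps B B) Φ := by
  refine ⟨hcp, fun m a Θ _ hΘ hsum i => ?_⟩
  have h1 := Ad_comp_eq_of_sum_eq_starAlgHom π a Θ hΘ (fun x => by rw [← hΦ, hsum]; simp) i
  have hstar := star_Ad_comp (hΘ i) (a i)
  set z := (Ad (a i) ∘ₗ Θ i) 1
  have hz : star z = z := by simpa [z] using hstar 1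
  have hcomm : ∀ x, π x * z = z * π x := by
    intro x
    have h2 := congrArg star (h1 (star x))
    rw [hstar, star_star, h1, star_mul, hz, map_star, star_star] at h2
    exact h2.symm
  refine ⟨z, ?_, fun x => ?_⟩
  · rintro _ ⟨x, rfl⟩
    simpa [hΦ] using congrArg (Subtype.val) (hcomm x)
  · rw [hΦ]
    exact congrArg Subtype.val (h1 x)

end

/-! ### The Cuntz algebra -/

section

variable {n : ℕ} {H : Type*} [NormedAddCommGroup H] [InnerProductSpace ℂ H] [CompleteSpace H]
  {S : Fin n → (H →L[ℂ] H)}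

theorem isCuntzTuple_gen (hS : IsCuntzFamily S) : IsCuntzTuple (gen S) where
  star_mul_self i := Subtype.ext (hS.isometry i)
  sum_mul_star := Subtype.ext (by simpa [gen] using hS.sum_mul_star)

theorem topGenerates_gen (S : Fin n → (H →L[ℂ] H)) : TopGenerates (gen S) := by
  refine eq_top_iff.2 fun x _ => ?_
  have hx : (x : H →L[ℂ] H) ∈ closure (StarAlgebra.adjoin ℂ (Set.range S) : Set (H →L[ℂ] H)) :=
    x.2
  have himg : (StarAlgebra.adjoin ℂ (Set.range (gen S))).map (cuntzAlgebra S).subtype =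
      StarAlgebra.adjoin ℂ (Set.range S) := by
    rw [StarAlgHom.map_adjoin, ← Set.range_comp]
    rfl
  have : x ∈ closure (StarAlgebra.adjoin ℂ (Set.range (gen S)) : Set (cuntzAlgebra S)) := by
    rw [Topology.IsInducing.subtypeVal.closure_eq_preimage_closure_image]
    rw [← himg] at hx
    exact hx
  exact this

theorem canonicalEndo_apply (hS : IsCuntzFamily S) (x : cuntzAlgebra S) :
    canonicalEndo S x = (isCuntzTuple_gen hS).endo x := by
  simp [canonicalEndo, Ad_apply, IsCuntzTuple.endo_apply]

theorem leftInverse_eq_linv (S : Fin n → (H →L[ℂ] H)) : leftInverse S = linv (gen S) := rfl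

theorem word_eq_listWord (S : Fin n → (H →L[ℂ] H)) {k : ℕ} (μ : Fin k → Fin n) :
    word S μ = listWord (gen S) (List.ofFn μ) := by
  rw [listWord, List.map_ofFn]; rfl

theorem uhfLevel_eq_levelSpan (S : Fin n → (H →L[ℂ] H)) (k : ℕ) :
    uhfLevel S k = levelSpan (gen S) k := by
  simp only [uhfLevel, levelSpan, word_eq_listWord]

theorem canonicalEndo_mem_cpMaps (S : Fin n → (H →L[ℂ] H)) :
    canonicalEndo S ∈ cpMaps (cuntzAlgebra S) (cuntzAlgebra S) :=
  sum_mem_cpMaps fun i => Ad_mem_cpMaps (gen S i)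

theorem isOperationalExtremePoint_canonicalEndo (hS : IsCuntzFamily S) :
    IsOperationalExtremePoint (cpMaps (cuntzAlgebra S) (cuntzAlgebra S)) (canonicalEndo S) :=
  isOperationalExtremePoint_of_starAlgHom (isCuntzTuple_gen hS).endo (canonicalEndo_apply hS)
    (canonicalEndo_mem_cpMaps S)

/-- The left inverse in the form `∑ Ad a_i ∘ Θ_i`, for the operational partition of unity that
consists of `n` copies of the scalar `n^{-1/2}`. -/
theorem leftInverse_eq_sum_Ad (S : Fin n → (H →L[ℂ] H)) :
    leftInverse S = ∑ i, Ad (((Real.sqrt n)⁻¹ : ℂ) • (1 : cuntzAlgebra S)) ∘ₗ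
      Ad (star (gen S i)) := by
  have h2 : (Real.sqrt n : ℂ) * Real.sqrt n = n := by
    exact_mod_cast Real.mul_self_sqrt (by positivity : (0 : ℝ) ≤ n)
  ext1 x
  simp only [leftInverse, LinearMap.smul_apply, LinearMap.sum_apply, LinearMap.comp_apply]
  rw [Finset.smul_sum]
  refine Finset.sum_congr rfl fun i _ => ?_
  rw [Ad_apply (((Real.sqrt n)⁻¹ : ℂ) • 1), star_smul, star_one, smul_mul_assoc, one_mul,
    mul_smul_comm, mul_one, smul_smul, star_inv₀, Complex.star_def, Complex.conj_ofReal, ← mul_inv,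
    h2]

theorem leftInverse_mem_cpMaps (S : Fin n → (H →L[ℂ] H)) :
    leftInverse S ∈ cpMaps (cuntzAlgebra S) (cuntzAlgebra S) := by
  have h : leftInverse S = ∑ i, Ad (((Real.sqrt n)⁻¹ : ℂ) • star (gen S i)) := by
    rw [leftInverse_eq_sum_Ad]
    refine Finset.sum_congr rfl fun i _ => LinearMap.ext fun x => ?_
    simp [Ad_apply]
  rw [h]
  exact sum_mem_cpMaps fun i => Ad_mem_cpMaps _

/-- For distinct `i, j` the projection `s_i s_i^*` is not a scalar: it is fixed by `s_i` and killed
by `s_j`. -/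
theorem IsCuntzTuple.gen_mul_star_ne_smul {A : Type*} [CStarAlgebra A] [Nontrivial A]
    {s : Fin n → A} (hs : IsCuntzTuple s) {i j : Fin n} (hij : i ≠ j) (c : ℂ) :
    s i * star (s i) ≠ c • (1 : A) := by
  intro h
  have h1 : star (s i) * (s i * star (s i)) * s i = 1 := by
    rw [hs.star_gen_mul_gen_mul, if_pos rfl, hs.star_mul_self]
  have h2 : star (s j) * (s i * star (s i)) * s j = 0 := by
    rw [hs.star_gen_mul_gen_mul, if_neg hij.symm, zero_mul]
  rw [h, mul_smul_comm, mul_one, smul_mul_assoc, hs.star_mul_self] at h1 h2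
  exact one_ne_zero (h1.symm.trans h2)

end

section

variable {n : ℕ} {H : Type*} [NormedAddCommGroup H] [InnerProductSpace ℂ H] [CompleteSpace H]
  [Nontrivial H] {S : Fin n → (H →L[ℂ] H)}

theorem not_isIrreducibleMap_canonicalEndo (hn : 2 ≤ n) (hS : IsCuntzFamily S) :
    ¬ IsIrreducibleMap (canonicalEndo S) := by
  have hs := isCuntzTuple_gen hS
  let i : Fin n := ⟨0, by omega⟩
  let j : Fin n := ⟨1, by omega⟩
  have hij : i ≠ j := by simp [i, j]
  intro h
  have hmem : ((gen S i * star (gen S i) : cuntzAlgebra S) : H →L[ℂ] H) ∈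
      imageCommutant (canonicalEndo S) := by
    rintro _ ⟨x, rfl⟩
    refine congrArg Subtype.val (?_ : canonicalEndo S x * (gen S i * star (gen S i)) =
      gen S i * star (gen S i) * canonicalEndo S x)
    rw [canonicalEndo_apply hS, ← mul_assoc, hs.endo_mul_gen, mul_assoc (gen S i) (star _),
      hs.star_gen_mul_endo, mul_assoc]
  rw [h] at hmem
  obtain ⟨c, hc⟩ := hmem
  exact hs.gen_mul_star_ne_smul hij c (Subtype.ext hc.symm)

theorem gen_ne_zero (hS : IsCuntzFamily S) (i : Fin n) : gen S i ≠ 0 := by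
  intro h
  have := (isCuntzTuple_gen hS).norm_gen i
  simp [h] at this

/-- The decomposition `Φ = ∑ Ad s_i` has summands that are not scalar multiples of `Φ`. -/
theorem not_isNumericalOperationalExtremePoint_canonicalEndo (hn : 2 ≤ n)
    (hS : IsCuntzFamily S) : ¬ IsNumericalOperationalExtremePoint
      (cpMaps (cuntzAlgebra S) (cuntzAlgebra S)) (canonicalEndo S) := by
  have hs := isCuntzTuple_gen hS
  let i : Fin n := ⟨0, by omega⟩
  let j : Fin n := ⟨1, by omega⟩
  have hij : i ≠ j := by simp [i, j]
  rintro ⟨-, h⟩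
  obtain ⟨r, -, hr⟩ := h n (gen S) (fun _ => LinearMap.id) ⟨gen_ne_zero hS, hs.sum_mul_star⟩
    (fun _ => id_mem_cpMaps) (by simp [canonicalEndo]) i
  have h1 := LinearMap.congr_fun hr 1
  rw [LinearMap.smul_apply, canonicalEndo_apply hS, map_one (isCuntzTuple_gen hS).endo] at h1
  refine hs.gen_mul_star_ne_smul hij r ?_
  simpa [Ad_apply] using h1

/-- The left inverse maps the projection `s_i s_i^*` to the scalar `1/n`. -/
theorem IsCuntzTuple.linv_gen_mul_star {A : Type*} [CStarAlgebra A] {s : Fin n → A}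
    (hs : IsCuntzTuple s) (i : Fin n) : linv s (s i * star (s i)) = (n : ℂ)⁻¹ • (1 : A) := by
  rw [hs.linv_gen_mul, hs.star_mul_self]

theorem not_isJordanHom_leftInverse (hn : 2 ≤ n) (hS : IsCuntzFamily S) :
    ¬ IsJordanHom (leftInverse S) := by
  have hs := isCuntzTuple_gen hS
  let i : Fin n := ⟨0, by omega⟩
  intro h
  have h1 := h.map_sq (gen S i * star (gen S i)) (IsSelfAdjoint.mul_star_self _)
  have hsq : (gen S i * star (gen S i)) ^ 2 = gen S i * star (gen S i) := by
    rw [sq, mul_assoc, hs.star_gen_mul_gen_mul, if_pos rfl]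
  rw [hsq, leftInverse_eq_linv, hs.linv_gen_mul_star, smul_pow, one_pow] at h1
  have h2 := smul_left_injective ℂ (one_ne_zero (α := cuntzAlgebra S)) h1
  have hn0 : (n : ℂ) ≠ 0 := hs.natCast_ne_zero
  field_simp at h2
  have h3 : n = 1 := by exact_mod_cast h2
  omega

/-- The decomposition `Ψ = ∑ (1/n) Ad s_i^*` is not operationally trivial: evaluation at `1` would
force `s_i^* x s_i = Ψ(x)` for all `i` and `x`. -/
theorem not_isOperationalExtremePoint_leftInverse (hn : 2 ≤ n) (hS : IsCuntzFamily S) :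
    ¬ IsOperationalExtremePoint (cpMaps (cuntzAlgebra S) (cuntzAlgebra S)) (leftInverse S) := by
  have hs := isCuntzTuple_gen hS
  let i : Fin n := ⟨0, by omega⟩
  let j : Fin n := ⟨1, by omega⟩
  have hij : i ≠ j := by simp [i, j]
  have hn0 : (n : ℂ) ≠ 0 := hs.natCast_ne_zero
  rintro ⟨-, h⟩
  set a : cuntzAlgebra S := ((Real.sqrt n)⁻¹ : ℂ) • 1
  have h2 : (Real.sqrt n : ℂ) * Real.sqrt n = n := by
    exact_mod_cast Real.mul_self_sqrt (by positivity : (0 : ℝ) ≤ n)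
  have ha : ∀ x, Ad a x = (n : ℂ)⁻¹ • x := by
    intro x
    rw [Ad_apply, star_smul, star_one, smul_mul_assoc, one_mul,
      mul_smul_comm, mul_one, smul_smul, star_inv₀, Complex.star_def, Complex.conj_ofReal,
      ← mul_inv, h2]
  have hfop : IsFOP (fun _ : Fin n => a) := by
    have haa : a * star a = (n : ℂ)⁻¹ • 1 := by simpa [Ad_apply] using ha 1
    refine ⟨fun _ h0 => ?_, ?_⟩
    · rw [h0, zero_mul] at haa
      exact smul_ne_zero (inv_ne_zero hn0) one_ne_zero haa.symm
    · simp [haa, ← Nat.cast_smul_eq_nsmul ℂ, smul_smul, hn0]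
  have hdec := h n (fun _ => a) (fun i => Ad (star (gen S i))) hfop
    (fun i => Ad_mem_cpMaps _) (leftInverse_eq_sum_Ad S)
  have key : ∀ k x, star (gen S k) * x * gen S k = leftInverse S x := by
    intro k x
    obtain ⟨z, -, hz⟩ := hdec k
    have hz1 := hz 1
    rw [ha, leftInverse_eq_linv, hs.linv_one, Ad_apply, star_star, mul_one, hs.star_mul_self] at hz1
    have hz2 : z = (((n : ℂ)⁻¹ • 1 : cuntzAlgebra S) : H →L[ℂ] H) := by
      rw [hz1]; exact (mul_one z).symm
    have hzx : (n : ℂ)⁻¹ • (star (gen S k) * x * gen S k) =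
        ((n : ℂ)⁻¹ • 1) * leftInverse S x := by
      rw [← star_star (gen S k), star_star (star (gen S k)), ← Ad_apply, ← ha]
      refine Subtype.ext ((hz x).trans ?_)
      rw [hz2]; rfl
    rw [smul_mul_assoc, one_mul] at hzx
    exact smul_right_injective _ (inv_ne_zero hn0) hzx
  have h1 := (key i (gen S i * star (gen S i))).trans (key j (gen S i * star (gen S i))).symm
  rw [hs.star_gen_mul_gen_mul, if_pos rfl, hs.star_mul_self, hs.star_gen_mul_gen_mul,
    if_neg hij.symm, zero_mul] at h1
  exact one_ne_zero h1

/-- The state `φ` with `φ(x) 1 = lim_k Ψ^k(x)`. -/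
noncomputable def canonicalState (hn : 2 ≤ n) (hS : IsCuntzFamily S) : cuntzAlgebra S →ₚ[ℂ] ℂ :=
  PositiveLinearMap.mk₀ (limitFunctional (isCuntzTuple_gen hS) (topGenerates_gen S) hn)
    fun _ => limitFunctional_nonneg (isCuntzTuple_gen hS) (topGenerates_gen S) hn

theorem canonicalState_apply (hn : 2 ≤ n) (hS : IsCuntzFamily S) (x : cuntzAlgebra S) :
    canonicalState hn hS x =
      limitFunctional (isCuntzTuple_gen hS) (topGenerates_gen S) hn x := rfl

theorem isUHFTraceLikeState_canonicalState (hn : 2 ≤ n) (hS : IsCuntzFamily S) :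
    IsUHFTraceLikeState S (canonicalState hn hS) where
  map_one := limitFunctional_one (isCuntzTuple_gen hS) (topGenerates_gen S) hn
  trace_like a b hb := by
    simp only [uhf, uhfLevel_eq_levelSpan] at hb
    exact limitFunctional_trace (isCuntzTuple_gen hS) (topGenerates_gen S) hn a hb

theorem IsUHFTraceLikeState.eq_canonicalState (hn : 2 ≤ n) (hS : IsCuntzFamily S)
    {ψ : cuntzAlgebra S →ₚ[ℂ] ℂ} (h : IsUHFTraceLikeState S ψ) : ψ = canonicalState hn hS := by
  refine PositiveLinearMap.ext fun x => ?_
  refine eq_limitFunctional_of_trace (isCuntzTuple_gen hS) (topGenerates_gen S) hn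
    ψ.toLinearMap (map_continuous ψ) h.map_one (fun k a b hb => h.trace_like a b ?_) x
  rw [← uhfLevel_eq_levelSpan] at hb
  exact subset_closure (Set.mem_iUnion.2 ⟨k, hb⟩)

theorem canonicalState_canonicalEndo (hn : 2 ≤ n) (hS : IsCuntzFamily S) (x : cuntzAlgebra S) :
    canonicalState hn hS (canonicalEndo S x) = canonicalState hn hS x := by
  rw [canonicalEndo_apply hS, canonicalState_apply, limitFunctional_endo, canonicalState_apply]

/-- The adjoint relation follows from `Ψ(y^* Φ(x)) = Ψ(y)^* x` and `φ ∘ Ψ = φ`. -/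
theorem isAdjointWrt_leftInverse (hn : 2 ≤ n) (hS : IsCuntzFamily S) :
    IsAdjointWrt (canonicalState hn hS) (canonicalEndo S) (leftInverse S) := by
  intro x y
  rw [canonicalState_apply, canonicalState_apply, ← limitFunctional_linv, canonicalEndo_apply hS,
    (isCuntzTuple_gen hS).linv_mul_endo, leftInverse_eq_linv, star_linv]

theorem IsAdjointWrt.eq_leftInverse (hn : 2 ≤ n) (hS : IsCuntzFamily S)
    {T : cuntzAlgebra S →ₗ[ℂ] cuntzAlgebra S}
    (h : IsAdjointWrt (canonicalState hn hS) (canonicalEndo S) T) : T = leftInverse S := by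
  refine LinearMap.ext fun y => sub_eq_zero.1 (star_eq_zero.1 ?_)
  refine eq_zero_of_limitFunctional_mul_eq_zero (isCuntzTuple_gen hS) (topGenerates_gen S) hn
    fun x => ?_
  rw [star_sub, sub_mul, map_sub, sub_eq_zero]
  exact (h x y).symm.trans (isAdjointWrt_leftInverse hn hS x y)

end

end CuntzCP


open CuntzCP in
theorem mainTheorem1 {n : ℕ} (hn : 2 ≤ n) {H : Type*} [NormedAddCommGroup H]
    [InnerProductSpace ℂ H] [CompleteSpace H] [Nontrivial H]
    (S : Fin n → (H →L[ℂ] H)) (hS : IsCuntzFamily S) :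
    -- not irreducible
    ¬ IsIrreducibleMap (canonicalEndo S) ∧
    -- operational extreme, but not numerically so
    (IsOperationalExtremePoint (cpMaps (cuntzAlgebra S) (cuntzAlgebra S)) (canonicalEndo S) ∧
      ¬ IsNumericalOperationalExtremePoint (cpMaps (cuntzAlgebra S) (cuntzAlgebra S))
        (canonicalEndo S)) ∧
    -- the adjoint with respect to the canonical state
    ∃ φ : cuntzAlgebra S →ₚ[ℂ] ℂ,
      IsUHFTraceLikeState S φ ∧ (∀ φ', IsUHFTraceLikeState S φ' → φ' = φ) ∧
      (∀ x, φ (canonicalEndo S x) = φ x) ∧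
      ∃ T : cuntzAlgebra S →ₗ[ℂ] cuntzAlgebra S,
        IsAdjointWrt φ (canonicalEndo S) T ∧
        (∀ T', IsAdjointWrt φ (canonicalEndo S) T' → T' = T) ∧
        T = leftInverse S ∧
        T ∈ cpMaps (cuntzAlgebra S) (cuntzAlgebra S) ∧
        ¬ IsOperationalExtremePoint (cpMaps (cuntzAlgebra S) (cuntzAlgebra S)) T ∧
        ¬ IsJordanHom T := by
  refine ⟨not_isIrreducibleMap_canonicalEndo hn hS,
    ⟨isOperationalExtremePoint_canonicalEndo hS,
      not_isNumericalOperationalExtremePoint_canonicalEndo hn hS⟩,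
    canonicalState hn hS, isUHFTraceLikeState_canonicalState hn hS,
    fun _ h => h.eq_canonicalState hn hS, canonicalState_canonicalEndo hn hS,
    leftInverse S, isAdjointWrt_leftInverse hn hS, fun _ h => h.eq_leftInverse hn hS, rfl,
    leftInverse_mem_cpMaps S, not_isOperationalExtremePoint_leftInverse hn hS,
    not_isJordanHom_leftInverse hn hS⟩
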